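/- Let $E=(E^0,E^1,r,s)$ be a row-finite directed graph (every vertex emits only finitely many edges; $E^0$ and $E^1$ may be infinite), let $K$ be a field, and let $n\in\mathbb Z\setminus\{0\}$. Let $L_K(E)$ be the Leavitt path algebra, that is, the (not necessarily unital) associative $K$-algebra generated by the vertices $v\in E^0$, the edges $e\in E^1$ and the ghost edges $e^*$ ($e\in E^1$), subject to $vw=\delta_{v,w}v$, $s(e)e=e=er(e)$, $r(e)e^*=e^*=e^*s(e)$, $e^*f=\delta_{e,f}r(e)$, and $v=\sum_{s(e)=v}ee^*$ for every vertex $v$ that emits at least one and only finitely many edges. It is $\mathbb Z$-graded: its component $L_K(E)_n$ of degree $n$ is the linear span of the elements $\alpha\beta^*$ with $\alpha,\beta$ finite paths (vertices being the paths of length $0$) and $l(\alpha)-l(\beta)=n$, where $l$ denotes length and $(e_1\cdots e_k)^*=e_k^*\cdots e_1^*$, $v^*=v$. Let $Z_n(L_K(E))=Z(L_K(E))\cap L_K(E)_n$, where $Z$ denotes the center. A cycle is a closed path $c=e_1\cdots e_k$, $k\ge 1$, with $s(e_i)\ne s(e_j)$ for $i\neq j$; $c^0=\{s(e_1),\dots,s(e_k)\}$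 is its set of vertices, and for $u=s(e_i)\in c^0$ we write $c_u=e_i\cdots e_ke_1\cdots e_{i-1}$ for the cycle $c$ based at $u$. The cycle $c$ is without exits if every edge $f$ with $s(f)=s(e_i)$ for some $i$ equals $e_i$. Let $\mathcal S$ be the set of all cycles $c$ without exits such that only finitely many paths end at a vertex of $c^0$ and do not contain all the edges of $c$. Let $F_E(c^0)$ be the set of paths $f_1\cdots f_t$, $t\ge1$, with $s(f_1)\notin c^0$, $r(f_i)\notin c^0$ for $i<t$ and $r(f_t)\in c^0$. For $m<0$ put $c_u^m=(c_u^*)^{-m}$. Then the set $$\mathcal B_n=\Big\{\sum_{\alpha\in F_E(c^0)\cup c^0}\ \sum_{u\in c^0}\alpha\,c_u^m\,\alpha^*\ \Big|\ c\in\mathcal S,\ m\in\mathbb Z,\ m\cdot l(c)=n\Big\}$$ is a $K$-basis of $Z_n(L_K(E))$. (The sums are finite, a summand vanishes unless $r(\alpha)=u$, and cycles whose length does not divide $n$ contribute no element.) -/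

import Mathlib

universe u v w

noncomputable section

/-- A directed graph `(E⁰, E¹, r, s)`: vertices, edges, and the range and source maps. Loops and
parallel edges are allowed and both sets may be infinite. -/
structure DirectedGraph where
  /-- The vertices `E⁰`. -/
  V : Type u
  /-- The edges `E¹`. -/
  E : Type v
  /-- The source map `s`. -/
  src : E → V
  /-- The range map `r`. -/
  rng : E → V

namespace DirectedGraph

variable (G : DirectedGraph.{u, v})

/-- `G` is row-finite if every vertex emits only finitely many edges. -/
def RowFinite : Prop := ∀ x : G.V, {e : G.E | G.src e = x}.Finite

/-- A regular vertex: it emits at least one and only finitely many edges. -/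
def IsRegular (x : G.V) : Prop :=
  {e : G.E | G.src e = x}.Nonempty ∧ {e : G.E | G.src e = x}.Finite

/-! ### Paths -/

/-- The edges of the list `e₁, …, eₙ` form a path that starts at `x`:
`s(e₁) = x` and `r(eᵢ) = s(eᵢ₊₁)` for `i < n`. -/
def IsPathFrom : G.V → List G.E → Prop
  | _, [] => True
  | x, e :: l => G.src e = x ∧ IsPathFrom (G.rng e) l

/-- The vertex at which a path with start `x` and the given list of edges ends. -/
def endpoint : G.V → List G.E → G.V
  | x, [] => x
  | _, e :: l => endpoint (G.rng e) l

/-- The set `Path(E)` of all finite paths. The paths of length `0` are the vertices. -/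
@[ext] structure Path where
  /-- The source of the path. -/
  source : G.V
  /-- The edges of the path, in order. -/
  edges : List G.E
  /-- Consecutive edges fit together. -/
  isPath : G.IsPathFrom source edges

variable {G}

/-- The range `r(α)` of a path. -/
def Path.range (α : G.Path) : G.V := G.endpoint α.source α.edges

/-- The length `l(α)` of a path. -/
def Path.length (α : G.Path) : ℕ := α.edges.length

variable (G)

/-- A vertex, viewed as a path of length `0`. -/
def vertexPath (x : G.V) : G.Path := ⟨x, [], trivial⟩

/-- `F_E(H)` for a set `H` of vertices: the paths `e₁ … eₙ` of length `n ≥ 1` with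
`s(e₁) ∉ H`, `r(eᵢ) ∉ H` for `i < n` and `r(eₙ) ∈ H`. As `r(eᵢ) = s(eᵢ₊₁)`, the first two
conditions say that no edge of the path has its source in `H`. -/
def pathsInto (H : Set G.V) : Set G.Path :=
  {α | α.edges ≠ [] ∧ (∀ e ∈ α.edges, G.src e ∉ H) ∧ α.range ∈ H}

/-! ### Cycles -/

/-- The set `μ⁰` of the vertices of a path `μ = e₁ … eₙ` with `n ≥ 1`. -/
def support (c : List G.E) : Set G.V := {x | ∃ e ∈ c, G.src e = x ∨ G.rng e = x}

/-- A cycle `c = e₁ … eₙ` (with `n ≥ 1`): a closed path whose edges have distinct sources. -/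
def IsCycle (c : List G.E) : Prop :=
  c ≠ [] ∧ (∃ x, G.IsPathFrom x c ∧ G.endpoint x c = x) ∧ (c.map G.src).Nodup

/-- The edge `f` is an exit for `c = e₁ … eₙ`: for some `i`, `s(f) = s(eᵢ)` and `f ≠ eᵢ`. -/
def IsExit (f : G.E) (c : List G.E) : Prop := ∃ e ∈ c, G.src f = G.src e ∧ f ≠ e

/-- The paths (of length `≥ 0`) that end at a vertex of `c` and do not contain all edges of `c`. -/
def pathsNotContaining (c : List G.E) : Set G.Path :=
  {α | α.range ∈ G.support c ∧ ¬ ∀ e ∈ c, e ∈ α.edges}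

/-- The set `𝒮` of the cycles `c` without exits such that only finitely many paths end at `c`
and do not contain `c`. -/
def cyclesS : Set (List G.E) :=
  {c | G.IsCycle c ∧ (∀ f, ¬ G.IsExit f c) ∧ (G.pathsNotContaining c).Finite}

open Classical in
/-- For a cycle `c = e₁ … eₙ` and `x = s(eᵢ)`, the cycle `c_x = eᵢ … eₙ e₁ … eᵢ₋₁` based
at `x`. -/
def basedAt (c : List G.E) (x : G.V) : List G.E :=
  c.rotate (c.findIdx fun e => G.src e = x)

/-- The paths `F_E(c⁰) ∪ c⁰`, where the vertices in `c⁰` are viewed as paths of length `0`. -/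
def sumIndex (c : List G.E) : Set G.Path :=
  G.pathsInto (G.support c) ∪ G.vertexPath '' G.support c

/-! ### The Leavitt path algebra -/

/-- The generators of the Leavitt path algebra: the vertices `x`, the (real) edges `e` and the
ghost edges `e*`. -/
inductive Gen
  | vertex (x : G.V)
  | edge (e : G.E)
  | ghost (e : G.E)

variable (K : Type w) [Field K]

/-- The free associative (non-unital) `K`-algebra on the generators: the semigroup algebra of the
semigroup of nonempty words in the generators. -/
abbrev FreeAlg : Type _ := MonoidAlgebra K (FreeSemigroup G.Gen)

/-- A generator as an element of the free algebra. -/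
def gen (g : G.Gen) : G.FreeAlg K := MonoidAlgebra.single (FreeSemigroup.of g) 1

open Classical in
/-- The defining relations of the Leavitt path algebra. -/
inductive Rel : G.FreeAlg K → G.FreeAlg K → Prop
  /-- (V): `x y = δ_{x,y} x` for vertices `x`, `y`. -/
  | vertex_mul (x y : G.V) :
      Rel (G.gen K (.vertex x) * G.gen K (.vertex y)) (if x = y then G.gen K (.vertex x) else 0)
  /-- (E1): `s(e) e = e`. -/
  | src_mul (e : G.E) :
      Rel (G.gen K (.vertex (G.src e)) * G.gen K (.edge e)) (G.gen K (.edge e))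
  /-- (E1): `e r(e) = e`. -/
  | mul_rng (e : G.E) :
      Rel (G.gen K (.edge e) * G.gen K (.vertex (G.rng e))) (G.gen K (.edge e))
  /-- (E2): `r(e) e* = e*`. -/
  | rng_mul (e : G.E) :
      Rel (G.gen K (.vertex (G.rng e)) * G.gen K (.ghost e)) (G.gen K (.ghost e))
  /-- (E2): `e* s(e) = e*`. -/
  | mul_src (e : G.E) :
      Rel (G.gen K (.ghost e) * G.gen K (.vertex (G.src e))) (G.gen K (.ghost e))
  /-- (CK1): `e* f = δ_{e,f} r(e)`. -/
  | ck1 (e f : G.E) :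
      Rel (G.gen K (.ghost e) * G.gen K (.edge f))
        (if e = f then G.gen K (.vertex (G.rng e)) else 0)
  /-- (CK2): `x = ∑ e e*` over the edges `e` with source `x`, for every regular vertex `x`. -/
  | ck2 (x : G.V) (hx : G.IsRegular x) :
      Rel (G.gen K (.vertex x))
        (∑ e ∈ hx.2.toFinset, G.gen K (.edge e) * G.gen K (.ghost e))

/-- The multiples by scalars of the defining relations. The ring congruence that they generate is
congruence modulo the two-sided algebra ideal generated by the differences `a - b`, `Rel a b`. -/
inductive ScaledRel : G.FreeAlg K → G.FreeAlg K → Prop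
  | smul (k : K) {a b : G.FreeAlg K} (h : G.Rel K a b) : ScaledRel (k • a) (k • b)

/-- The congruence on the free algebra generated by the defining relations. -/
def leavittCon : RingCon (G.FreeAlg K) := ringConGen (G.ScaledRel K)

theorem leavittCon_smul (k : K) {a b : G.FreeAlg K} (h : G.leavittCon K a b) :
    G.leavittCon K (k • a) (k • b) := by
  change RingConGen.Rel (G.ScaledRel K) a b at h
  change RingConGen.Rel (G.ScaledRel K) (k • a) (k • b)
  induction h with
  | of a b h =>
    obtain ⟨l, h⟩ := h
    rw [smul_smul, smul_smul]
    exact .of _ _ (.smul _ h)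
  | refl a => exact .refl _
  | symm _ ih => exact .symm ih
  | trans _ _ ih₁ ih₂ => exact .trans ih₁ ih₂
  | add _ _ ih₁ ih₂ => rw [smul_add, smul_add]; exact .add ih₁ ih₂
  | mul _ h₂ ih₁ _ =>
    rw [← smul_mul_assoc, ← smul_mul_assoc]
    exact .mul ih₁ h₂

/-- The Leavitt path algebra `L_K(E)` of the graph `G`: the quotient of the free associative
`K`-algebra on vertices, edges and ghost edges by the relations (V), (E1), (E2), (CK1), (CK2). It
is not assumed to have a unit. -/
def LPA : Type _ := (G.leavittCon K).Quotient

instance : NonUnitalRing (G.LPA K) :=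
  inferInstanceAs (NonUnitalRing (G.leavittCon K).Quotient)

/-- The quotient map from the free algebra. -/
def mkLPA (a : G.FreeAlg K) : G.LPA K := RingCon.toQuotient (c := G.leavittCon K) a

theorem mkLPA_surjective : Function.Surjective (G.mkLPA K) := Quotient.mk''_surjective

theorem mkLPA_eq_iff {a b : G.FreeAlg K} :
    G.mkLPA K a = G.mkLPA K b ↔ G.leavittCon K a b := (G.leavittCon K).eq

theorem mkLPA_zero : G.mkLPA K 0 = 0 := rfl

theorem mkLPA_add (a b : G.FreeAlg K) : G.mkLPA K (a + b) = G.mkLPA K a + G.mkLPA K b := rfl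

theorem mkLPA_mul (a b : G.FreeAlg K) : G.mkLPA K (a * b) = G.mkLPA K a * G.mkLPA K b := rfl

instance : SMul K (G.LPA K) where
  smul k := Quotient.map' (k • ·) fun _ _ h => G.leavittCon_smul K k h

theorem mkLPA_smul (k : K) (a : G.FreeAlg K) : G.mkLPA K (k • a) = k • G.mkLPA K a := rfl

instance : Module K (G.LPA K) where
  one_smul x := by
    obtain ⟨a, rfl⟩ := G.mkLPA_surjective K x
    rw [← mkLPA_smul, one_smul]
  mul_smul k l x := by
    obtain ⟨a, rfl⟩ := G.mkLPA_surjective K x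
    simp only [← mkLPA_smul, mul_smul]
  smul_zero k := by rw [← mkLPA_zero, ← mkLPA_smul, smul_zero]
  smul_add k x y := by
    obtain ⟨a, rfl⟩ := G.mkLPA_surjective K x
    obtain ⟨b, rfl⟩ := G.mkLPA_surjective K y
    simp only [← mkLPA_smul, ← mkLPA_add, smul_add]
  add_smul k l x := by
    obtain ⟨a, rfl⟩ := G.mkLPA_surjective K x
    simp only [← mkLPA_smul, ← mkLPA_add, add_smul]
  zero_smul x := by
    obtain ⟨a, rfl⟩ := G.mkLPA_surjective K x
    rw [← mkLPA_smul, zero_smul, mkLPA_zero]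

instance : IsScalarTower K (G.LPA K) (G.LPA K) where
  smul_assoc k x y := by
    obtain ⟨a, rfl⟩ := G.mkLPA_surjective K x
    obtain ⟨b, rfl⟩ := G.mkLPA_surjective K y
    simp only [smul_eq_mul, ← mkLPA_smul, ← mkLPA_mul, smul_mul_assoc]

instance : SMulCommClass K (G.LPA K) (G.LPA K) where
  smul_comm k x y := by
    obtain ⟨a, rfl⟩ := G.mkLPA_surjective K x
    obtain ⟨b, rfl⟩ := G.mkLPA_surjective K y
    simp only [smul_eq_mul, ← mkLPA_smul, ← mkLPA_mul, mul_smul_comm]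

/-- The element of the Leavitt path algebra given by a vertex, an edge or a ghost edge. -/
def ι (g : G.Gen) : G.LPA K := G.mkLPA K (G.gen K g)

/-- The element `e₁ ⋯ eₙ` for a path `e₁ … eₙ` that starts at `x` (and `x` itself if `n = 0`). -/
def real : G.V → List G.E → G.LPA K
  | x, [] => G.ι K (.vertex x)
  | _, e :: l => G.ι K (.edge e) * real (G.rng e) l

/-- The element `eₙ* ⋯ e₁*` for a path `e₁ … eₙ` that starts at `x` (and `x` if `n = 0`). -/
def ghost : G.V → List G.E → G.LPA K
  | x, [] => G.ι K (.vertex x)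
  | _, e :: l => ghost (G.rng e) l * G.ι K (.ghost e)

variable {G} in
/-- A path `α` as an element of the Leavitt path algebra. -/
def Path.toLPA (α : G.Path) : G.LPA K := G.real K α.source α.edges

variable {G} in
/-- The element `α*` of the Leavitt path algebra. -/
def Path.star (α : G.Path) : G.LPA K := G.ghost K α.source α.edges

/-- The component of degree `n` of the Leavitt path algebra, spanned by the elements `α β*` with
`l(α) - l(β) = n`. -/
def degreePart (n : ℤ) : Submodule K (G.LPA K) :=
  Submodule.span K {x | ∃ α β : G.Path, (α.length : ℤ) - β.length = n ∧ x = α.toLPA K * β.star K}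

/-- `Z_n(L_K(E))`: the elements of degree `n` in the center of the Leavitt path algebra. -/
def centerPart (n : ℤ) : Submodule K (G.LPA K) :=
  (NonUnitalSubalgebra.center K (G.LPA K)).toSubmodule ⊓ G.degreePart K n

/-- The power `cᵐ`, `m ∈ ℤ`, of a closed path `c` based at `x`. It is the `m`-fold concatenation
of `c` for `m ≥ 0` (in particular `c⁰ = x`), and `(c*)⁻ᵐ` for `m < 0`. -/
def closedPow (x : G.V) (c : List G.E) (m : ℤ) : G.LPA K :=
  if 0 ≤ m then G.real K x (List.replicate m.natAbs c).flatten
  else G.ghost K x (List.replicate m.natAbs c).flatten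

/-- For a cycle `c`, the sum `∑ α c_x^m α*` over the paths `α ∈ F_E(c⁰) ∪ c⁰` and the vertices
`x ∈ c⁰`. A summand is zero unless `r(α) = x`. -/
def cycleSum (c : List G.E) (m : ℤ) : G.LPA K :=
  ∑ᶠ (α ∈ G.sumIndex c) (x ∈ G.support c),
    α.toLPA K * G.closedPow K x (G.basedAt c x) m * α.star K

/-- The sums `∑ α c_x^m α*` with `c ∈ 𝒮` and `m · l(c) = n`. -/
def basisSet (n : ℤ) : Set (G.LPA K) :=
  {x | ∃ c ∈ G.cyclesS, ∃ m : ℤ, m * (c.length : ℤ) = n ∧ x = G.cycleSum K c m}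

/-- The sums `cycleSum` for cycles in `𝒮` are sums over finite index sets. -/
theorem finite_support (c : List G.E) : (G.support c).Finite := by
  have : G.support c ⊆ {x | x ∈ c.map G.src ++ c.map G.rng} := by
    rintro x ⟨e, he, rfl | rfl⟩ <;> simp only [Set.mem_ofPred_eq, List.mem_append, List.mem_map]
    exacts [Or.inl ⟨e, he, rfl⟩, Or.inr ⟨e, he, rfl⟩]
  exact (List.finite_toSet _).subset this

theorem finite_sumIndex {c : List G.E} (hc : c ∈ G.cyclesS) : (G.sumIndex c).Finite := by
  refine (hc.2.2.subset ?_).union ((G.finite_support c).image _)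
  rintro α ⟨-, h, hr⟩
  refine ⟨hr, fun hall => ?_⟩
  obtain ⟨e, he⟩ := List.exists_mem_of_ne_nil c hc.1.1
  exact h e (hall e he) ⟨e, he, Or.inl rfl⟩

end DirectedGraph

end

/-! The involution exchanging `e` and `e*` reverses degrees and turns the sum attached to `(c, m)`
into the one attached to `(c, -m)`. So it is enough to treat n > 0.

Let z be central of degree n > 0. For a path l, r(l) z = l* l z = l* z l. If l is at least as long
as every β in some expression of z by terms α β*, then CK1 turns each l* α β* l into 0 or a closed
path of length n at w = r(l) (`exists_ghost_mul_mul_real_mem`). So w z is a combination of closed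
paths of length n. If p = e q occurs in it with coefficient k ≠ 0 and f ≠ e starts at w, then k f =
p* z f = q* (e* z f) = q* (z e* f) = 0, which is absurd because vertices are nonzero. Hence each
such w with w z ≠ 0 emits exactly one edge (`exists_closedPath_of_mem_longEnds`). These w make up
cycles c without exits, and w z is a multiple of a power of c_w.

Such w exist if z ≠ 0: repeated use of CK2 pushes x z along all paths, and sinks contribute nothing
because n ≠ 0 (`vx_mul_eq_zero_of_forall_path`). The set of x with x z ≠ 0 is finite and contains
the source of every path whose range it contains, which forces c ∈ 𝒮
(`mem_cyclesS_of_subset_longEnds`). Subtracting the right multiple of the sum attached to c removes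
w from this finite set and adds nothing to it, so induction shows that the sums span
(`centerPart_natCast_le`).

The sums commute with edges because β ↦ e β matches their summands (`cycleSum_mul_ed`), and then
with ghost edges by CK2. They are independent because a vertex of c annihilates all of them but its
own, from which it cuts out a single nonzero path. -/

noncomputable section

namespace DirectedGraph

variable {G : DirectedGraph.{u, v}} {K : Type w} [Field K]

/-! ### The universal property -/

section Lift

variable {A : Type*} [NonUnitalSemiring A] [Module K A] [IsScalarTower K A A]
  [SMulCommClass K A A]

variable (K) in
/-- The extension of a map on generators to the free algebra. -/
def liftFree (f : G.Gen → A) : G.FreeAlg K →ₙₐ[K] A :=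
  MonoidAlgebra.liftMagma K (FreeSemigroup.lift f)

@[simp]
theorem liftFree_gen (f : G.Gen → A) (g : G.Gen) : liftFree K f (G.gen K g) = f g := by
  simp [liftFree, gen, MonoidAlgebra.liftMagma]

theorem liftFree_eq_of_leavittCon (f : G.Gen → A)
    (h : ∀ a b, G.Rel K a b → liftFree K f a = liftFree K f b) {a b : G.FreeAlg K}
    (hab : G.leavittCon K a b) : liftFree K f a = liftFree K f b := by
  change RingConGen.Rel (G.ScaledRel K) a b at hab
  induction hab with
  | of a b hab =>
    obtain ⟨k, hab⟩ := hab
    rw [map_smul, map_smul, h _ _ hab]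
  | refl => rfl
  | symm _ ih => exact ih.symm
  | trans _ _ ih₁ ih₂ => exact ih₁.trans ih₂
  | add _ _ ih₁ ih₂ => rw [map_add, map_add, ih₁, ih₂]
  | mul _ _ ih₁ ih₂ => rw [map_mul, map_mul, ih₁, ih₂]

/-- The universal property of the Leavitt path algebra. -/
def lift (f : G.Gen → A) (h : ∀ a b, G.Rel K a b → liftFree K f a = liftFree K f b) :
    G.LPA K →ₙₐ[K] A where
  toFun := Quotient.lift (liftFree K f) fun _ _ hab => liftFree_eq_of_leavittCon f h hab
  map_smul' k x := by
    obtain ⟨a, rfl⟩ := G.mkLPA_surjective K x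
    exact map_smul (liftFree K f) k a
  map_zero' := map_zero (liftFree K f)
  map_add' x y := by
    obtain ⟨a, rfl⟩ := G.mkLPA_surjective K x
    obtain ⟨b, rfl⟩ := G.mkLPA_surjective K y
    exact map_add (liftFree K f) a b
  map_mul' x y := by
    obtain ⟨a, rfl⟩ := G.mkLPA_surjective K x
    obtain ⟨b, rfl⟩ := G.mkLPA_surjective K y
    exact map_mul (liftFree K f) a b

@[simp]
theorem lift_ι (f : G.Gen → A) (h : ∀ a b, G.Rel K a b → liftFree K f a = liftFree K f b)
    (g : G.Gen) : lift f h (G.ι K g) = f g :=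
  liftFree_gen f g

end Lift

variable (G K) in
/-- The quotient map from the free algebra, as a homomorphism of algebras. -/
def mkHom : G.FreeAlg K →ₙₐ[K] G.LPA K where
  toFun := G.mkLPA K
  map_smul' := G.mkLPA_smul K
  map_zero' := G.mkLPA_zero K
  map_add' := G.mkLPA_add K
  map_mul' := G.mkLPA_mul K

/-- A linear property of elements that is closed under products and holds for the generators holds
everywhere. -/
theorem LPA.induction {p : G.LPA K → Prop} (hι : ∀ g, p (G.ι K g)) (hzero : p 0)
    (hadd : ∀ a b, p a → p b → p (a + b)) (hsmul : ∀ (k : K) a, p a → p (k • a))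
    (hmul : ∀ a b, p a → p b → p (a * b)) (a : G.LPA K) : p a := by
  obtain ⟨a, rfl⟩ := G.mkLPA_surjective K a
  induction a using MonoidAlgebra.induction_linear with
  | zero => exact hzero
  | add a b ha hb => exact hadd _ _ ha hb
  | single w k =>
    have : (MonoidAlgebra.single w k : G.FreeAlg K) = k • MonoidAlgebra.single w 1 := by
      simp
    rw [this, mkLPA_smul]
    refine hsmul _ _ ?_
    induction w using FreeSemigroup.recOnMul with
    | ih1 g => exact hι g
    | ih2 x w h₁ h₂ =>
      have : (MonoidAlgebra.single (FreeSemigroup.of x * w) 1 : G.FreeAlg K) =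
          MonoidAlgebra.single (FreeSemigroup.of x) 1 * MonoidAlgebra.single w 1 := by simp
      rw [this, mkLPA_mul]
      exact hmul _ _ (h₁ (by simp)) (h₂ (by simp))

/-! ### Relations between the generators -/

theorem mkLPA_eq_of_rel {a b : G.FreeAlg K} (h : G.Rel K a b) : G.mkLPA K a = G.mkLPA K b := by
  rw [mkLPA_eq_iff]
  have := RingConGen.Rel.of _ _ (ScaledRel.smul (1 : K) h)
  rw [one_smul, one_smul] at this
  exact this

variable (K) in
/-- A vertex as an element of the Leavitt path algebra. -/
abbrev vx (x : G.V) : G.LPA K := G.ι K (.vertex x)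

variable (K) in
/-- An edge as an element of the Leavitt path algebra. -/
abbrev ed (e : G.E) : G.LPA K := G.ι K (.edge e)

variable (K) in
/-- A ghost edge as an element of the Leavitt path algebra. -/
abbrev gh (e : G.E) : G.LPA K := G.ι K (.ghost e)

@[simp]
theorem vx_mul_self (x : G.V) : vx K x * vx K x = vx K x :=
  (mkLPA_eq_of_rel (Rel.vertex_mul x x)).trans (by rw [if_pos rfl]; rfl)

theorem vx_mul_vx_of_ne {x y : G.V} (h : x ≠ y) : vx K x * vx K y = 0 :=
  (mkLPA_eq_of_rel (Rel.vertex_mul x y)).trans (by rw [if_neg h]; rfl)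

@[simp]
theorem vx_src_mul_ed (e : G.E) : vx K (G.src e) * ed K e = ed K e :=
  mkLPA_eq_of_rel (Rel.src_mul e)

@[simp]
theorem ed_mul_vx_rng (e : G.E) : ed K e * vx K (G.rng e) = ed K e :=
  mkLPA_eq_of_rel (Rel.mul_rng e)

@[simp]
theorem vx_rng_mul_gh (e : G.E) : vx K (G.rng e) * gh K e = gh K e :=
  mkLPA_eq_of_rel (Rel.rng_mul e)

@[simp]
theorem gh_mul_vx_src (e : G.E) : gh K e * vx K (G.src e) = gh K e :=
  mkLPA_eq_of_rel (Rel.mul_src e)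

@[simp]
theorem gh_mul_ed_self (e : G.E) : gh K e * ed K e = vx K (G.rng e) :=
  (mkLPA_eq_of_rel (Rel.ck1 e e)).trans (by rw [if_pos rfl]; rfl)

theorem gh_mul_ed_of_ne {e f : G.E} (h : e ≠ f) : gh K e * ed K f = 0 :=
  (mkLPA_eq_of_rel (Rel.ck1 e f)).trans (by rw [if_neg h]; rfl)

theorem vx_eq_sum {x : G.V} (hx : G.IsRegular x) :
    vx K x = ∑ e ∈ hx.2.toFinset, ed K e * gh K e := by
  refine (mkLPA_eq_of_rel (Rel.ck2 x hx)).trans ?_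
  exact map_sum (G.mkHom K) _ _

/-! ### The involution -/

section Star

open MulOpposite

instance : IsScalarTower K (G.LPA K)ᵐᵒᵖ (G.LPA K)ᵐᵒᵖ where
  smul_assoc k x y := unop_injective (mul_smul_comm k y.unop x.unop)

instance : SMulCommClass K (G.LPA K)ᵐᵒᵖ (G.LPA K)ᵐᵒᵖ where
  smul_comm k x y := unop_injective (smul_mul_assoc k y.unop x.unop).symm

/-- The images of the generators under the involution. -/
def starGen : G.Gen → (G.LPA K)ᵐᵒᵖ
  | .vertex x => op (vx K x)
  | .edge e => op (gh K e)
  | .ghost e => op (ed K e)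

variable (G K) in
/-- The involution of the Leavitt path algebra that exchanges edges and ghost edges. -/
def starHom : G.LPA K →ₙₐ[K] (G.LPA K)ᵐᵒᵖ :=
  lift starGen fun a b h => by
    induction h with
    | vertex_mul x y =>
      rcases eq_or_ne x y with rfl | h
      · simp [starGen, ← op_mul]
      · simp [starGen, ← op_mul, h, vx_mul_vx_of_ne h.symm]
    | src_mul e => simp [starGen, ← op_mul]
    | mul_rng e => simp [starGen, ← op_mul]
    | rng_mul e => simp [starGen, ← op_mul]
    | mul_src e => simp [starGen, ← op_mul]
    | ck1 e f =>
      rcases eq_or_ne e f with rfl | h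
      · simp [starGen, ← op_mul]
      · simp [starGen, ← op_mul, h, gh_mul_ed_of_ne h.symm]
    | ck2 x hx =>
      simp only [liftFree_gen, starGen, map_sum, map_mul, ← op_mul]
      rw [vx_eq_sum hx]
      exact map_sum (opAddEquiv (α := G.LPA K)) _ _

theorem unop_starHom_unop_starHom (a : G.LPA K) :
    (starHom G K (starHom G K a).unop).unop = a := by
  induction a using LPA.induction with
  | hι g => cases g <;> simp [starHom, starGen]
  | hzero => simp
  | hadd a b ha hb => simp [ha, hb]
  | hsmul k a ha => simp [ha]
  | hmul a b ha hb => simp [ha, hb]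

instance : StarRing (G.LPA K) where
  star a := (starHom G K a).unop
  star_involutive := unop_starHom_unop_starHom
  star_mul a b := by simp
  star_add a b := by simp

theorem star_def (a : G.LPA K) : Star.star a = (starHom G K a).unop := rfl

@[simp]
theorem star_vx (x : G.V) : Star.star (vx K x) = vx K x := by simp [star_def, starHom, starGen]

@[simp]
theorem star_ed (e : G.E) : Star.star (ed K e) = gh K e := by simp [star_def, starHom, starGen]

@[simp]
theorem star_gh (e : G.E) : Star.star (gh K e) = ed K e := by simp [star_def, starHom, starGen]

theorem star_smul' (k : K) (a : G.LPA K) : Star.star (k • a) = k • Star.star a := by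
  simp [star_def]

variable (G K) in
/-- The involution as a linear equivalence. -/
def starLinear : G.LPA K ≃ₗ[K] G.LPA K :=
  { starAddEquiv with map_smul' := star_smul' }

@[simp]
theorem starLinear_apply (a : G.LPA K) : starLinear G K a = Star.star a := rfl

end Star

/-! ### Vertices are nonzero -/

section Representation

/-- Bijections between `{x} × ℕ` and `s⁻¹(x) × ℕ` for the vertices `x` that emit edges: `ψ e k`
is the second coordinate of the element that corresponds to `(e, k)`, and `χ e` is a left inverse
of `ψ e`. -/
structure IsCoding (ψ χ : G.E → ℕ → ℕ) : Prop where
  left_inv : ∀ e k, χ e (ψ e k) = k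
  inj : ∀ e f k l, G.src e = G.src f → ψ e k = ψ f l → e = f
  surj : ∀ x, G.IsRegular x → ∀ j, ∃ e, G.src e = x ∧ ψ e (χ e j) = j

/-- At a regular vertex, `s⁻¹(x) × ℕ` is countably infinite, so it is in bijection with ℕ. -/
theorem exists_isCoding (hG : G.RowFinite) : ∃ ψ χ : G.E → ℕ → ℕ, IsCoding ψ χ := by
  have key : ∀ x, G.IsRegular x → Nonempty (ℕ ≃ {e : G.E | G.src e = x} × ℕ) := by
    intro x hx
    have := hx.1.to_subtype
    have := hx.2.to_subtype
    exact nonempty_equiv_of_countable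
  have hreg : ∀ e, G.IsRegular (G.src e) := fun e => ⟨⟨e, rfl⟩, hG _⟩
  have α := fun x hx => (key x hx).some
  let ψ : G.E → ℕ → ℕ := fun e k => (α _ (hreg e)).symm (⟨e, rfl⟩, k)
  let χ : G.E → ℕ → ℕ := fun e j => (α _ (hreg e) j).2
  have hψ : ∀ x (hx : G.IsRegular x) e (he : G.src e = x) k,
      α x hx (ψ e k) = (⟨e, he⟩, k) := by
    rintro _ hx e rfl k
    simp [ψ]
  refine ⟨ψ, χ, fun e k => by simp [ψ, χ], fun e f k l h hkl => ?_, fun x hx j => ?_⟩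
  · have h₁ := hψ _ (hreg f) e h k
    rw [hkl, hψ _ (hreg f) f rfl l] at h₁
    simpa using (congrArg (fun p => p.1.1) h₁).symm
  · refine ⟨(α x hx j).1.1, (α x hx j).1.2, ?_⟩
    apply (α x hx).injective
    rw [hψ x hx _ (α x hx j).1.2]
    have : ∀ e, G.src e = x → χ e j = (α x hx j).2 := by
      rintro e rfl
      rfl
    rw [this _ (α x hx j).1.2]

variable {ψ χ : G.E → ℕ → ℕ}

open Classical in
variable (K ψ χ) in
/-- Operators on functions on `V × ℕ` attached to a coding. -/
def repGen : G.Gen → Module.End K (G.V → ℕ → K)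
  | .vertex x =>
    { toFun := fun g y j => if x = y then g y j else 0
      map_add' := fun g h => by ext y j; simp only [Pi.add_apply]; split_ifs <;> simp
      map_smul' := fun k g => by ext y j; simp }
  -- The condition `ψ e (χ e j) = j` says that `j` lies in the range of `ψ e`.
  | .edge e =>
    { toFun := fun g y j => if G.src e = y ∧ ψ e (χ e j) = j then g (G.rng e) (χ e j) else 0
      map_add' := fun g h => by ext y j; simp only [Pi.add_apply]; split_ifs <;> simp
      map_smul' := fun k g => by ext y j; simp }
  | .ghost e =>
    { toFun := fun g y j => if G.rng e = y then g (G.src e) (ψ e j) else 0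
      map_add' := fun g h => by ext y j; simp only [Pi.add_apply]; split_ifs <;> simp
      map_smul' := fun k g => by ext y j; simp }

open Classical in
theorem repGen_vertex_apply (x y : G.V) (g : G.V → ℕ → K) (j : ℕ) :
    repGen K ψ χ (.vertex x) g y j = if x = y then g y j else 0 := by
  simp [repGen]

open Classical in
theorem repGen_edge_apply (e : G.E) (y : G.V) (g : G.V → ℕ → K) (j : ℕ) :
    repGen K ψ χ (.edge e) g y j =
      if G.src e = y ∧ ψ e (χ e j) = j then g (G.rng e) (χ e j) else 0 := by
  simp [repGen]

open Classical in
theorem repGen_ghost_apply (e : G.E) (y : G.V) (g : G.V → ℕ → K) (j : ℕ) :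
    repGen K ψ χ (.ghost e) g y j = if G.rng e = y then g (G.src e) (ψ e j) else 0 := by
  simp [repGen]

theorem liftFree_repGen_eq_of_rel (h : IsCoding ψ χ) {a b : G.FreeAlg K} (hab : G.Rel K a b) :
    liftFree K (repGen K ψ χ) a = liftFree K (repGen K ψ χ) b := by
  classical
  refine LinearMap.ext fun g => funext fun y => funext fun j => ?_
  induction hab with
  | vertex_mul x z =>
    rcases eq_or_ne x z with rfl | hxz
    · simp +contextual [repGen_vertex_apply]
    · simp only [hxz, map_mul, liftFree_gen, Module.End.mul_apply, repGen_vertex_apply, if_false,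
        map_zero, LinearMap.zero_apply, Pi.zero_apply]
      split_ifs with h₁ h₂
      · exact (hxz (h₁.trans h₂.symm)).elim
      all_goals rfl
  | src_mul e =>
    simp only [map_mul, liftFree_gen, Module.End.mul_apply, repGen_vertex_apply, repGen_edge_apply]
    grind
  | mul_rng e =>
    simp only [map_mul, liftFree_gen, Module.End.mul_apply, repGen_vertex_apply, repGen_edge_apply]
    grind
  | rng_mul e =>
    simp only [map_mul, liftFree_gen, Module.End.mul_apply, repGen_vertex_apply,
      repGen_ghost_apply]
    grind
  | mul_src e =>
    simp only [map_mul, liftFree_gen, Module.End.mul_apply, repGen_vertex_apply,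
      repGen_ghost_apply]
    grind
  | ck1 e f =>
    rcases eq_or_ne e f with rfl | hef
    · simp only [map_mul, liftFree_gen, Module.End.mul_apply, repGen_vertex_apply,
        repGen_ghost_apply, repGen_edge_apply, h.left_inv, if_true]
      grind
    · have := h.inj f e
      simp only [map_mul, liftFree_gen, Module.End.mul_apply,
        repGen_ghost_apply, repGen_edge_apply, if_neg hef, map_zero, LinearMap.zero_apply,
        Pi.zero_apply]
      grind
  | ck2 x hx =>
    simp only [liftFree_gen, map_sum, map_mul, LinearMap.sum_apply, Finset.sum_apply,
      Module.End.mul_apply, repGen_vertex_apply, repGen_edge_apply, repGen_ghost_apply, if_true]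
    by_cases hxy : x = y
    · subst hxy
      obtain ⟨e, he, hej⟩ := h.surj x hx j
      rw [if_pos rfl, Finset.sum_eq_single e]
      · rw [if_pos ⟨he, hej⟩, he, hej]
      · intro f hf hfe
        rw [if_neg]
        rintro ⟨h₁, h₂⟩
        exact hfe (h.inj f e _ _ (h₁.trans he.symm) (h₂.trans hej.symm))
      · intro hne
        exact (hne (by simpa using he)).elim
    · rw [if_neg hxy]
      refine (Finset.sum_eq_zero fun e he => if_neg ?_).symm
      rintro ⟨h₁, -⟩
      exact hxy ((show G.src e = x by simpa using he).symm.trans h₁)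

end Representation

/-- In a row-finite graph, the vertices are nonzero elements of the Leavitt path algebra. -/
theorem vx_ne_zero (hG : G.RowFinite) (x : G.V) : vx K x ≠ 0 := by
  obtain ⟨ψ, χ, h⟩ := exists_isCoding hG
  intro h0
  have h₁ := congrArg (lift (repGen K ψ χ) fun _ _ => liftFree_repGen_eq_of_rel h) h0
  rw [lift_ι, map_zero] at h₁
  -- The constant function 1, acted on by `x`, still has the value 1 at `(x, 0)`.
  have h₂ := congrFun (congrFun (LinearMap.congr_fun h₁ fun _ _ => 1) x) 0
  simp [repGen_vertex_apply] at h₂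

/-! ### Lists of edges -/

theorem isPathFrom_append {x : G.V} {a b : List G.E} :
    G.IsPathFrom x (a ++ b) ↔ G.IsPathFrom x a ∧ G.IsPathFrom (G.endpoint x a) b := by
  induction a generalizing x with
  | nil => simp [IsPathFrom, endpoint]
  | cons e a ih => simp [IsPathFrom, endpoint, ih, and_assoc]

@[simp]
theorem endpoint_append (x : G.V) (a b : List G.E) :
    G.endpoint x (a ++ b) = G.endpoint (G.endpoint x a) b := by
  induction a generalizing x with
  | nil => rfl
  | cons e a ih => simp [endpoint, ih]

theorem isPathFrom_flatten_replicate {x : G.V} {c : List G.E} (hc : G.IsPathFrom x c)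
    (hx : G.endpoint x c = x) (m : ℕ) :
    G.IsPathFrom x (List.replicate m c).flatten ∧
      G.endpoint x (List.replicate m c).flatten = x := by
  induction m with
  | zero => simp [IsPathFrom, endpoint]
  | succ m ih =>
    rw [List.replicate_succ, List.flatten_cons, isPathFrom_append, endpoint_append, hx]
    exact ⟨⟨hc, ih.1⟩, ih.2⟩

theorem finite_isPathFrom (hG : G.RowFinite) (x : G.V) (k : ℕ) :
    {l | G.IsPathFrom x l ∧ l.length = k}.Finite := by
  induction k generalizing x with
  | zero =>
    refine (Set.finite_singleton []).subset ?_
    rintro l ⟨-, hl⟩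
    exact List.length_eq_zero_iff.1 hl
  | succ k ih =>
    refine ((hG x).biUnion fun e _ => (ih (G.rng e)).image (List.cons e)).subset ?_
    rintro (_ | ⟨e, l⟩) ⟨h, hl⟩
    · simp at hl
    · simp only [Set.mem_iUnion]
      exact ⟨e, h.1, l, ⟨h.2, by simpa using hl⟩, rfl⟩

theorem finite_paths_of_length_le (hG : G.RowFinite) {F : Set G.V} (hF : F.Finite) (k : ℕ) :
    {α : G.Path | α.source ∈ F ∧ α.length ≤ k}.Finite := by
  have h : (⋃ x ∈ F, ⋃ j ∈ Set.Iic k,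
      Prod.mk x '' {l | G.IsPathFrom x l ∧ l.length = j}).Finite :=
    hF.biUnion fun x _ => (Set.finite_Iic k).biUnion fun j _ => (finite_isPathFrom hG x j).image _
  refine Set.Finite.of_finite_image (f := fun α : G.Path => (α.source, α.edges))
    (h.subset ?_) ?_
  · rintro _ ⟨α, ⟨hα, hk⟩, rfl⟩
    simp only [Set.mem_iUnion]
    exact ⟨α.source, hα, α.length, hk, α.edges, ⟨α.isPath, rfl⟩, rfl⟩
  · intro α _ β _ h
    simp only [Prod.mk.injEq] at h
    exact Path.ext h.1 h.2

/-! ### Path monomials -/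

theorem vx_mul_real {x : G.V} {l : List G.E} (h : G.IsPathFrom x l) :
    vx K x * G.real K x l = G.real K x l := by
  cases l with
  | nil => simp [real]
  | cons e l =>
    obtain ⟨rfl, -⟩ := h
    rw [real, ← mul_assoc, vx_src_mul_ed]

theorem vx_mul_real_of_ne {x y : G.V} {l : List G.E} (h : G.IsPathFrom x l) (hxy : y ≠ x) :
    vx K y * G.real K x l = 0 := by
  rw [← vx_mul_real h, ← mul_assoc, vx_mul_vx_of_ne hxy, zero_mul]

theorem real_mul_vx (x : G.V) (l : List G.E) :
    G.real K x l * vx K (G.endpoint x l) = G.real K x l := by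
  induction l generalizing x with
  | nil => simp [real, endpoint]
  | cons e l ih => rw [real, endpoint, mul_assoc, ih]

theorem real_mul_real {x : G.V} {a b : List G.E} (h : G.IsPathFrom x (a ++ b)) :
    G.real K x a * G.real K (G.endpoint x a) b = G.real K x (a ++ b) := by
  induction a generalizing x with
  | nil => exact vx_mul_real h
  | cons e a ih => rw [real, endpoint, mul_assoc, ih h.2, List.cons_append, real]

theorem real_mul_real_of_ne {x y : G.V} {a b : List G.E} (hb : G.IsPathFrom y b)
    (hne : G.endpoint x a ≠ y) : G.real K x a * G.real K y b = 0 := by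
  rw [← real_mul_vx, mul_assoc, vx_mul_real_of_ne hb hne, mul_zero]

theorem real_mul_ed {x : G.V} {l : List G.E} {e : G.E} (h : G.IsPathFrom x l)
    (he : G.src e = G.endpoint x l) : G.real K x l * ed K e = G.real K x (l ++ [e]) := by
  have h' : G.IsPathFrom x (l ++ [e]) := isPathFrom_append.2 ⟨h, he, trivial⟩
  rw [← real_mul_real h', real, real, ed_mul_vx_rng]

@[simp]
theorem star_real (x : G.V) (l : List G.E) : Star.star (G.real K x l) = G.ghost K x l := by
  induction l generalizing x with
  | nil => simp [real, ghost]
  | cons e l ih => simp [real, ghost, ih]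

@[simp]
theorem star_ghost (x : G.V) (l : List G.E) : Star.star (G.ghost K x l) = G.real K x l := by
  rw [← star_real, star_star]

theorem ghost_mul_vx {x : G.V} {l : List G.E} (h : G.IsPathFrom x l) :
    G.ghost K x l * vx K x = G.ghost K x l := by
  simpa using congrArg Star.star (vx_mul_real (K := K) h)

theorem ghost_mul_vx_of_ne {x y : G.V} {l : List G.E} (h : G.IsPathFrom x l) (hxy : y ≠ x) :
    G.ghost K x l * vx K y = 0 := by
  simpa using congrArg Star.star (vx_mul_real_of_ne (K := K) h hxy)

/-- CK1 cancels the edges in pairs from the middle outwards, and the first mismatch gives 0. The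
compression of homogeneous elements by long paths rests on this computation. -/
theorem ghost_mul_real_eq_zero_or {x y : G.V} {a b : List G.E} (ha : G.IsPathFrom x a)
    (hb : G.IsPathFrom y b) (hab : a.length ≤ b.length) :
    G.ghost K x a * G.real K y b = 0 ∨
      x = y ∧ ∃ p, b = a ++ p ∧ G.ghost K x a * G.real K y b = G.real K (G.endpoint x a) p := by
  induction a generalizing x y b with
  | nil =>
    rcases eq_or_ne x y with rfl | hne
    · exact Or.inr ⟨rfl, b, rfl, vx_mul_real hb⟩
    · exact Or.inl (vx_mul_real_of_ne hb hne)
  | cons e a ih =>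
    cases b with
    | nil => simp at hab
    | cons f b =>
      have hassoc : G.ghost K x (e :: a) * G.real K y (f :: b) =
          G.ghost K (G.rng e) a * (gh K e * ed K f) * G.real K (G.rng f) b := by
        simp only [ghost, real, mul_assoc]
      rcases eq_or_ne e f with rfl | hne
      · rw [hassoc, gh_mul_ed_self, ghost_mul_vx ha.2]
        rcases ih ha.2 hb.2 (by simpa using hab) with h | ⟨-, p, rfl, h⟩
        · exact Or.inl h
        · exact Or.inr ⟨ha.1.symm.trans hb.1, p, rfl, h⟩
      · rw [hassoc, gh_mul_ed_of_ne hne, mul_zero, zero_mul]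
        exact Or.inl rfl

theorem ghost_mul_real_self {x : G.V} {l : List G.E} (h : G.IsPathFrom x l) :
    G.ghost K x l * G.real K x l = vx K (G.endpoint x l) := by
  induction l generalizing x with
  | nil => simp [ghost, real, endpoint]
  | cons e l ih =>
    calc _ = G.ghost K (G.rng e) l * (gh K e * ed K e) * G.real K (G.rng e) l := by
          simp only [ghost, real, mul_assoc]
      _ = _ := by rw [gh_mul_ed_self, ghost_mul_vx h.2, ih h.2, endpoint]

theorem ghost_mul_real_of_ne {x y : G.V} {a b : List G.E} (ha : G.IsPathFrom x a)
    (hb : G.IsPathFrom y b) (hab : a.length = b.length) (hne : a ≠ b) :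
    G.ghost K x a * G.real K y b = 0 := by
  rcases ghost_mul_real_eq_zero_or (K := K) ha hb hab.le with h | ⟨-, p, rfl, -⟩
  · exact h
  · have : p = [] := by simpa using hab
    simp [this] at hne

theorem real_ne_zero (hG : G.RowFinite) {x : G.V} {l : List G.E} (h : G.IsPathFrom x l) :
    G.real K x l ≠ 0 := by
  intro h0
  apply vx_ne_zero (K := K) hG (G.endpoint x l)
  rw [← ghost_mul_real_self h, h0, mul_zero]

/-! ### Sets of vertices in which paths are determined by their length -/

/-- A set of vertices that is closed under the edges it emits and such that each of its vertices
emits at most one edge. -/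
structure IsDet (A : Set G.V) : Prop where
  rng_mem : ∀ e, G.src e ∈ A → G.rng e ∈ A
  eq_of_src : ∀ e f, G.src e ∈ A → G.src e = G.src f → e = f

namespace IsDet

variable {A : Set G.V} (hA : IsDet A)
include hA

theorem endpoint_mem {x : G.V} (hx : x ∈ A) {l : List G.E} (h : G.IsPathFrom x l) :
    G.endpoint x l ∈ A := by
  induction l generalizing x with
  | nil => exact hx
  | cons e l ih =>
    obtain ⟨rfl, h⟩ := h
    exact ih (hA.rng_mem _ hx) h

theorem src_mem {x : G.V} (hx : x ∈ A) {l : List G.E} (h : G.IsPathFrom x l) {e : G.E}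
    (he : e ∈ l) : G.src e ∈ A := by
  induction l generalizing x with
  | nil => simp at he
  | cons f l ih =>
    obtain ⟨rfl, h⟩ := h
    rcases List.mem_cons.1 he with rfl | he
    · exact hx
    · exact ih (hA.rng_mem _ hx) h he

theorem isPrefix {x : G.V} (hx : x ∈ A) {a b : List G.E} (ha : G.IsPathFrom x a)
    (hb : G.IsPathFrom x b) (hab : a.length ≤ b.length) : a <+: b := by
  induction a generalizing x b with
  | nil => exact List.nil_prefix
  | cons e a ih =>
    cases b with
    | nil => simp at hab
    | cons f b =>
      obtain ⟨rfl, ha⟩ := ha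
      obtain rfl := hA.eq_of_src e f hx hb.1.symm
      exact List.cons_prefix_cons.2 ⟨rfl, ih (hA.rng_mem _ hx) ha hb.2 (by simpa using hab)⟩

theorem eq_of_length {x : G.V} (hx : x ∈ A) {a b : List G.E} (ha : G.IsPathFrom x a)
    (hb : G.IsPathFrom x b) (hab : a.length = b.length) : a = b :=
  (hA.isPrefix hx ha hb hab.le).eq_of_length hab

/-- A path that starts and ends at a closed path stays in any closed set containing its end. -/
theorem mem_of_endpoint_mem {B : Set G.V} (hB : IsDet B) {x : G.V} (hx : x ∈ A) {q l : List G.E}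
    (hq : G.IsPathFrom x q) (hqx : G.endpoint x q = x) (hq0 : q ≠ []) (hl : G.IsPathFrom x l)
    (hlB : G.endpoint x l ∈ B) : x ∈ B := by
  -- Since `q` is nonempty, `l.length` copies of it are at least as long as `l`. So `l` is a prefix
  -- of this closed path, and the rest of it leads from a vertex of `B` back to `x`.
  obtain ⟨h₁, h₂⟩ := isPathFrom_flatten_replicate hq hqx l.length
  obtain ⟨r, hr⟩ := hA.isPrefix hx hl h₁ (by
    have := List.length_pos_iff.2 hq0
    simp only [List.length_flatten, List.map_replicate, List.sum_replicate, smul_eq_mul]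
    exact Nat.le_mul_of_pos_right _ this)
  rw [← hr, isPathFrom_append] at h₁
  rw [← hr, endpoint_append] at h₂
  rw [← h₂]
  exact hB.endpoint_mem hlB h₁.2

end IsDet

/-! ### Cycles without exits -/

/-- The range of an edge of `c` is the source of the next edge, cyclically. -/
theorem IsCycle.exists_src {c : List G.E} (hc : G.IsCycle c) {x : G.V} (hx : x ∈ G.support c) :
    ∃ e ∈ c, G.src e = x := by
  obtain ⟨hc0, ⟨y, hy, hyy⟩, -⟩ := hc
  obtain ⟨e, he, rfl | rfl⟩ := hx
  · exact ⟨e, he, rfl⟩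
  · obtain ⟨a, b, rfl⟩ := List.append_of_mem he
    rw [isPathFrom_append] at hy
    rw [endpoint_append, endpoint] at hyy
    cases b with
    | cons f b => exact ⟨f, by simp, hy.2.2.1⟩
    | nil =>
      rw [endpoint] at hyy
      cases a with
      | nil => exact ⟨e, by simp, by rw [hyy]; exact hy.2.1⟩
      | cons f a => exact ⟨f, by simp, by rw [hyy]; exact hy.1.1⟩

theorem isDet_support {c : List G.E} (hc : G.IsCycle c) (hex : ∀ f, ¬ G.IsExit f c) :
    IsDet (G.support c) := by
  have key : ∀ e, G.src e ∈ G.support c → e ∈ c := by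
    intro e he
    obtain ⟨f, hf, hfe⟩ := hc.exists_src he
    by_contra hec
    exact hex e ⟨f, hf, hfe.symm, fun h => hec (h ▸ hf)⟩
  refine ⟨fun e he => ⟨e, key e he, Or.inr rfl⟩, fun e f he hef => ?_⟩
  by_contra hne
  exact hex e ⟨f, key f (hef ▸ he), hef, hne⟩

theorem IsCycle.basedAt_isPathFrom {c : List G.E} (hc : G.IsCycle c) {x : G.V}
    (hx : x ∈ G.support c) :
    G.IsPathFrom x (G.basedAt c x) ∧ G.endpoint x (G.basedAt c x) = x := by
  classical
  obtain ⟨e, he, hex⟩ := hc.exists_src hx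
  obtain ⟨-, ⟨y, hy, hyy⟩, -⟩ := hc
  have hlt : c.findIdx (fun e => G.src e = x) < c.length :=
    List.findIdx_lt_length_of_exists ⟨e, he, by simpa using hex⟩
  have hsrc := List.findIdx_getElem (w := hlt)
  have hrot : G.basedAt c x = c.drop (c.findIdx fun e => G.src e = x) ++
      c.take (c.findIdx fun e => G.src e = x) := by
    rw [basedAt]
    convert List.rotate_eq_drop_append_take hlt.le
  generalize c.findIdx (fun e => G.src e = x) = i at *
  rw [hrot]
  rw [← List.take_append_drop i c, isPathFrom_append] at hy
  rw [← List.take_append_drop i c, endpoint_append] at hyy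
  have hxi : G.endpoint y (c.take i) = x := by
    have h := hy.2
    rw [List.drop_eq_getElem_cons hlt] at h
    rw [← h.1]
    simpa using hsrc
  rw [hxi] at hy hyy
  rw [isPathFrom_append, endpoint_append, hyy]
  exact ⟨⟨hy.2, hy.1⟩, hxi⟩

theorem length_basedAt (c : List G.E) (x : G.V) : (G.basedAt c x).length = c.length := by
  simp [basedAt]

theorem mem_basedAt {c : List G.E} {x : G.V} {e : G.E} : e ∈ G.basedAt c x ↔ e ∈ c := by
  simp [basedAt]

theorem support_subset_of_mem {c : List G.E} (hc : G.IsCycle c) {A : Set G.V} (hA : IsDet A)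
    {x : G.V} (hx : x ∈ G.support c) (hxA : x ∈ A) : G.support c ⊆ A := by
  intro y hy
  obtain ⟨e, he, rfl⟩ := hc.exists_src hy
  exact hA.src_mem hxA (hc.basedAt_isPathFrom hx).1 (mem_basedAt.2 he)

/-- The list of edges of the power `c_x^m`. -/
def powList (c : List G.E) (m : ℕ) (x : G.V) : List G.E :=
  (List.replicate m (G.basedAt c x)).flatten

theorem IsCycle.powList_isPathFrom {c : List G.E} (hc : G.IsCycle c) (m : ℕ) {x : G.V}
    (hx : x ∈ G.support c) :
    G.IsPathFrom x (powList c m x) ∧ G.endpoint x (powList c m x) = x :=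
  isPathFrom_flatten_replicate (hc.basedAt_isPathFrom hx).1 (hc.basedAt_isPathFrom hx).2 m

@[simp]
theorem length_powList (c : List G.E) (m : ℕ) (x : G.V) :
    (powList c m x).length = m * c.length := by
  simp [powList, length_basedAt]

theorem closedPow_natCast (c : List G.E) (m : ℕ) (x : G.V) :
    G.closedPow K x (G.basedAt c x) m = G.real K x (powList c m x) := by
  simp [closedPow, powList]

/-! ### The sums attached to cycles without exits -/

theorem range_mem_of_mem_sumIndex {c : List G.E} {α : G.Path} (hα : α ∈ G.sumIndex c) :
    α.range ∈ G.support c := by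
  rcases hα with hα | ⟨x, hx, rfl⟩
  · exact hα.2.2
  · exact hx

theorem vertexPath_mem_sumIndex {c : List G.E} {x : G.V} (hx : x ∈ G.support c) :
    G.vertexPath x ∈ G.sumIndex c :=
  Or.inr ⟨x, hx, rfl⟩

theorem eq_vertexPath_of_mem_sumIndex {c : List G.E} {α : G.Path} (hα : α ∈ G.sumIndex c)
    (h : α.source ∈ G.support c) : α = G.vertexPath α.source := by
  rcases hα with ⟨h0, hs, -⟩ | ⟨x, hx, rfl⟩
  · obtain ⟨x, _ | ⟨e, l⟩, hp⟩ := α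
    · exact (h0 rfl).elim
    · exact (hs e (by simp) (hp.1 ▸ h)).elim
  · rfl

/-- This makes β ↦ e β a bijection between the summands to be compared in `cycleSum_mul_ed`. -/
theorem cons_mem_sumIndex_iff {c : List G.E} {x : G.V} {e : G.E} {l : List G.E}
    (h : G.IsPathFrom x (e :: l)) (he : G.src e ∉ G.support c) :
    ⟨x, e :: l, h⟩ ∈ G.sumIndex c ↔ ⟨G.rng e, l, h.2⟩ ∈ G.sumIndex c := by
  constructor
  · rintro (⟨-, hs, hr⟩ | ⟨y, -, hy⟩)
    · cases l with
      | nil => exact Or.inr ⟨G.rng e, hr, rfl⟩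
      | cons f l => exact Or.inl ⟨by simp, fun g hg => hs g (List.mem_cons_of_mem _ hg), hr⟩
    · simp [vertexPath, Path.ext_iff] at hy
  · intro hl
    have hr := range_mem_of_mem_sumIndex hl
    refine Or.inl ⟨by simp, ?_, hr⟩
    rcases hl with ⟨-, hs, -⟩ | ⟨y, -, hy⟩
    · intro g hg
      rcases List.mem_cons.1 hg with rfl | hg
      · exact he
      · exact hs g hg
    · obtain rfl : [] = l := congrArg Path.edges hy
      simpa using he

variable (K) in
/-- The summand `α c_x^m α*` with `x = r(α)`. -/
def cycleTerm (c : List G.E) (m : ℕ) (α : G.Path) : G.LPA K :=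
  α.toLPA K * G.real K α.range (powList c m α.range) * α.star K

theorem cycleTerm_cons (c : List G.E) (m : ℕ) {x : G.V} {e : G.E} {l : List G.E}
    (h : G.IsPathFrom x (e :: l)) :
    cycleTerm K c m ⟨x, e :: l, h⟩ =
      ed K e * cycleTerm K c m ⟨G.rng e, l, h.2⟩ * gh K e := by
  simp only [cycleTerm, Path.toLPA, Path.star, Path.range, real, ghost, endpoint, mul_assoc]

theorem vx_mul_cycleTerm (c : List G.E) (m : ℕ) (α : G.Path) :
    vx K α.source * cycleTerm K c m α = cycleTerm K c m α := by
  rw [cycleTerm, Path.toLPA, mul_assoc, ← mul_assoc, vx_mul_real α.isPath]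

theorem cycleTerm_mul_vx (c : List G.E) (m : ℕ) (α : G.Path) :
    cycleTerm K c m α * vx K α.source = cycleTerm K c m α := by
  rw [cycleTerm, Path.star, mul_assoc, ghost_mul_vx α.isPath]

theorem vx_mul_cycleTerm_of_ne (c : List G.E) (m : ℕ) {α : G.Path} {x : G.V}
    (h : x ≠ α.source) : vx K x * cycleTerm K c m α = 0 := by
  rw [← vx_mul_cycleTerm, ← mul_assoc, vx_mul_vx_of_ne h, zero_mul]

theorem cycleTerm_mul_vx_of_ne (c : List G.E) (m : ℕ) {α : G.Path} {x : G.V}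
    (h : x ≠ α.source) : cycleTerm K c m α * vx K x = 0 := by
  rw [← cycleTerm_mul_vx, mul_assoc, vx_mul_vx_of_ne h.symm, mul_zero]

theorem ed_mul_cycleTerm_of_ne (c : List G.E) (m : ℕ) {α : G.Path} {e : G.E}
    (h : G.rng e ≠ α.source) : ed K e * cycleTerm K c m α = 0 := by
  rw [← ed_mul_vx_rng, mul_assoc, vx_mul_cycleTerm_of_ne c m h, mul_zero]

theorem cycleTerm_mul_ed_of_ne (c : List G.E) (m : ℕ) {α : G.Path} {e : G.E}
    (h : G.src e ≠ α.source) : cycleTerm K c m α * ed K e = 0 := by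
  rw [← vx_src_mul_ed, ← mul_assoc, cycleTerm_mul_vx_of_ne c m h, zero_mul]

theorem IsCycle.cycleTerm_vertexPath {c : List G.E} (hc : G.IsCycle c) (m : ℕ) {x : G.V}
    (hx : x ∈ G.support c) :
    cycleTerm K c m (G.vertexPath x) = G.real K x (powList c m x) := by
  have h := hc.powList_isPathFrom m hx
  have h' := real_mul_vx (K := K) x (powList c m x)
  rw [h.2] at h'
  change vx K x * G.real K x (powList c m x) * vx K x = _
  rw [vx_mul_real h.1, h']

section CycleSum

variable {c : List G.E} (hc : c ∈ G.cyclesS) (m : ℕ)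
include hc

theorem isDet_of_mem_cyclesS : IsDet (G.support c) := isDet_support hc.1 hc.2.1

variable (K) in
theorem cycleSum_eq_sum :
    G.cycleSum K c m = ∑ α ∈ (G.finite_sumIndex hc).toFinset, cycleTerm K c m α := by
  rw [cycleSum, finsum_mem_eq_finite_toFinset_sum _ (G.finite_sumIndex hc)]
  refine Finset.sum_congr rfl fun α hα => ?_
  have hα : α ∈ G.sumIndex c := by simpa using hα
  have hr := range_mem_of_mem_sumIndex hα
  rw [finsum_mem_eq_finite_toFinset_sum _ (G.finite_support c),
    Finset.sum_eq_single α.range]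
  · rw [closedPow_natCast, cycleTerm]
  · intro y hy hne
    have hy : y ∈ G.support c := by simpa using hy
    rw [closedPow_natCast, Path.toLPA,
      real_mul_real_of_ne (hc.1.powList_isPathFrom m hy).1 hne.symm, zero_mul]
  · intro h
    simp [hr] at h

/-- At a vertex of the cycle, `cycleSum` is the power of the cycle. -/
theorem vx_mul_cycleSum {x : G.V} (hx : x ∈ G.support c) :
    vx K x * G.cycleSum K c m = G.real K x (powList c m x) := by
  rw [cycleSum_eq_sum K hc, Finset.mul_sum, Finset.sum_eq_single (G.vertexPath x)]
  · rw [hc.1.cycleTerm_vertexPath m hx]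
    exact vx_mul_real (hc.1.powList_isPathFrom m hx).1
  · intro α hα hne
    have hα : α ∈ G.sumIndex c := by simpa using hα
    refine vx_mul_cycleTerm_of_ne c m fun h => hne ?_
    subst h
    exact eq_vertexPath_of_mem_sumIndex hα hx
  · intro h
    simp [vertexPath_mem_sumIndex hx] at h

theorem vx_mul_cycleSum_eq_zero {x : G.V} (hx : ∀ α ∈ G.sumIndex c, α.source ≠ x) :
    vx K x * G.cycleSum K c m = 0 := by
  rw [cycleSum_eq_sum K hc, Finset.mul_sum]
  refine Finset.sum_eq_zero fun α hα => vx_mul_cycleTerm_of_ne c m (hx α ?_).symm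
  simpa using hα

theorem vx_mul_cycleSum_comm (x : G.V) :
    vx K x * G.cycleSum K c m = G.cycleSum K c m * vx K x := by
  rw [cycleSum_eq_sum K hc, Finset.mul_sum, Finset.sum_mul]
  refine Finset.sum_congr rfl fun α _ => ?_
  rcases eq_or_ne x α.source with rfl | h
  · rw [vx_mul_cycleTerm, cycleTerm_mul_vx]
  · rw [vx_mul_cycleTerm_of_ne c m h, cycleTerm_mul_vx_of_ne c m h]

/-- Both sides are paths of the same length from the same vertex of a cycle without exits, so they
coincide. -/
theorem real_powList_mul_ed {e : G.E} (he : G.src e ∈ G.support c) :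
    G.real K (G.src e) (powList c m (G.src e)) * ed K e =
      ed K e * G.real K (G.rng e) (powList c m (G.rng e)) := by
  have hA := isDet_of_mem_cyclesS hc
  have h₁ := hc.1.powList_isPathFrom m he
  have h₂ := hc.1.powList_isPathFrom m (hA.rng_mem _ he)
  have h₃ : G.IsPathFrom (G.src e) (powList c m (G.src e) ++ [e]) :=
    isPathFrom_append.2 ⟨h₁.1, h₁.2.symm, trivial⟩
  rw [real_mul_ed h₁.1 h₁.2.symm]
  change _ = G.real K (G.src e) (e :: powList c m (G.rng e))
  rw [hA.eq_of_length he h₃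
    (show G.IsPathFrom (G.src e) (e :: powList c m (G.rng e)) from ⟨rfl, h₂.1⟩) (by simp)]

/-- If `s(e)` lies on the cycle, only the powers of the cycle at `s(e)` and `r(e)` matter.
Otherwise, write T_α for the summand of α. Then T_{eβ} = e T_β e*, whence T_{eβ} e = e T_β, and the
remaining products vanish on both sides. -/
theorem cycleSum_mul_ed (e : G.E) :
    G.cycleSum K c m * ed K e = ed K e * G.cycleSum K c m := by
  by_cases he : G.src e ∈ G.support c
  · rw [← vx_src_mul_ed, ← mul_assoc, ← vx_mul_cycleSum_comm hc, vx_mul_cycleSum hc m he,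
      real_powList_mul_ed hc m he, ← vx_mul_cycleSum hc m ((isDet_of_mem_cyclesS hc).rng_mem e he),
      ← mul_assoc, ed_mul_vx_rng, vx_src_mul_ed]
  · rw [cycleSum_eq_sum K hc, Finset.mul_sum, Finset.sum_mul]
    symm
    have hsrc : ∀ β : G.Path, ed K e * cycleTerm K c m β ≠ 0 → G.rng e = β.source := by
      intro β h
      by_contra hne
      exact h (ed_mul_cycleTerm_of_ne c m hne)
    have hpath : ∀ β : G.Path, G.rng e = β.source → G.IsPathFrom (G.src e) (e :: β.edges) :=
      fun β h => ⟨rfl, by rw [h]; exact β.isPath⟩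
    -- Only the β with `e T_β ≠ 0` start at `r(e)`, so that `e β` is a path. Hence the bijection is
    -- between nonzero terms only.
    refine Finset.sum_bij_ne_zero
      (fun β _ h => ⟨G.src e, e :: β.edges, hpath β (hsrc β h)⟩) ?_ ?_ ?_ ?_
    · rintro ⟨x, l, hl⟩ hβ h
      have := hsrc _ h
      dsimp only at this
      subst this
      simpa [cons_mem_sumIndex_iff _ he] using hβ
    · intro β₁ _ h₁ β₂ _ h₂ h
      simp only [Path.mk.injEq, List.cons.injEq, true_and] at h
      exact Path.ext ((hsrc _ h₁).symm.trans (hsrc _ h₂)) h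
    · rintro ⟨x, l, hl⟩ hα h
      have hα : ⟨x, l, hl⟩ ∈ G.sumIndex c := by simpa using hα
      have hx : G.src e = x := by
        by_contra hne
        exact h (cycleTerm_mul_ed_of_ne c m hne)
      subst hx
      cases l with
      | nil =>
        exact (he (range_mem_of_mem_sumIndex hα)).elim
      | cons f l =>
        have hfe : f = e := by
          by_contra hne
          rw [cycleTerm_cons, mul_assoc, gh_mul_ed_of_ne hne, mul_zero] at h
          exact h rfl
        subst hfe
        rw [cons_mem_sumIndex_iff _ he] at hα
        refine ⟨⟨G.rng f, l, hl.2⟩, by simpa using hα, fun h0 => h ?_, rfl⟩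
        rw [cycleTerm_cons, h0, zero_mul, zero_mul]
    · rintro ⟨x, l, hl⟩ hβ h
      have := hsrc _ h
      dsimp only at this
      subst this
      rw [cycleTerm_cons, mul_assoc, gh_mul_ed_self, mul_assoc, cycleTerm_mul_vx c m ⟨_, l, hl⟩]

/-- With C the sum, inserting CK2 at `s(e)` gives e* C = ∑ e* C f f* = ∑ e* f C f*, where only f = e
survives and yields C e*. -/
theorem gh_mul_cycleSum (hG : G.RowFinite) (e : G.E) :
    gh K e * G.cycleSum K c m = G.cycleSum K c m * gh K e := by
  have hreg : G.IsRegular (G.src e) := ⟨⟨e, rfl⟩, hG _⟩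
  calc gh K e * G.cycleSum K c m
      = gh K e * (vx K (G.src e) * G.cycleSum K c m) := by rw [← mul_assoc, gh_mul_vx_src]
    _ = ∑ f ∈ hreg.2.toFinset, gh K e * (G.cycleSum K c m * (ed K f * gh K f)) := by
        rw [vx_mul_cycleSum_comm hc, vx_eq_sum hreg, Finset.mul_sum, Finset.mul_sum]
    _ = gh K e * (G.cycleSum K c m * (ed K e * gh K e)) := by
        refine Finset.sum_eq_single e (fun f _ hfe => ?_) (by simp)
        rw [← mul_assoc _ (ed K f), cycleSum_mul_ed hc, ← mul_assoc, ← mul_assoc,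
          gh_mul_ed_of_ne hfe.symm, zero_mul, zero_mul]
    _ = G.cycleSum K c m * gh K e := by
        rw [← mul_assoc _ (ed K e), cycleSum_mul_ed hc, ← mul_assoc, ← mul_assoc,
          gh_mul_ed_self, vx_mul_cycleSum_comm hc, mul_assoc, vx_rng_mul_gh]

theorem cycleSum_mem_center (hG : G.RowFinite) (a : G.LPA K) :
    a * G.cycleSum K c m = G.cycleSum K c m * a := by
  induction a using LPA.induction with
  | hι g =>
    cases g with
    | vertex x => exact vx_mul_cycleSum_comm hc m x
    | edge e => exact (cycleSum_mul_ed hc m e).symm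
    | ghost e => exact gh_mul_cycleSum hc m hG e
  | hzero => simp
  | hadd a b ha hb => rw [add_mul, mul_add, ha, hb]
  | hsmul k a ha => rw [smul_mul_assoc, mul_smul_comm, ha]
  | hmul a b ha hb => rw [mul_assoc, hb, ← mul_assoc, ha, mul_assoc]

theorem cycleSum_mem_degreePart :
    G.cycleSum K c m ∈ G.degreePart K ((m : ℤ) * c.length) := by
  rw [cycleSum_eq_sum K hc]
  refine Submodule.sum_mem _ fun α hα => ?_
  have hα : α ∈ G.sumIndex c := by simpa using hα
  have hp := hc.1.powList_isPathFrom m (range_mem_of_mem_sumIndex hα)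
  have hp' : G.IsPathFrom α.source (α.edges ++ powList c m α.range) :=
    isPathFrom_append.2 ⟨α.isPath, hp.1⟩
  refine Submodule.subset_span ⟨⟨α.source, _, hp'⟩, α, ?_, ?_⟩
  · simp [Path.length]
  · rw [cycleTerm, Path.toLPA, Path.toLPA, ← real_mul_real hp']
    rfl

end CycleSum

/-! ### Linear independence in positive degree -/

theorem mem_basisSet_natCast {n : ℕ} {a : G.LPA K} : a ∈ G.basisSet K n ↔
    ∃ c ∈ G.cyclesS, ∃ m : ℕ, m * c.length = n ∧ a = G.cycleSum K c m := by
  constructor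
  · rintro ⟨c, hc, m, hm, rfl⟩
    have hpos : (0 : ℤ) < c.length := by exact_mod_cast List.length_pos_iff.2 hc.1.1
    have hm0 : 0 ≤ m := nonneg_of_mul_nonneg_left (hm ▸ Int.natCast_nonneg n) hpos
    lift m to ℕ using hm0
    exact ⟨c, hc, m, by exact_mod_cast hm, rfl⟩
  · rintro ⟨c, hc, m, hm, rfl⟩
    exact ⟨c, hc, m, by exact_mod_cast hm, rfl⟩

theorem basisSet_natCast_subset (hG : G.RowFinite) (n : ℕ) :
    G.basisSet K n ⊆ G.centerPart K n := by
  intro a ha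
  obtain ⟨c, hc, m, rfl, rfl⟩ := mem_basisSet_natCast.1 ha
  refine ⟨(NonUnitalSubalgebra.mem_center_iff (R := K)).2 (cycleSum_mem_center hc m hG), ?_⟩
  push_cast
  exact cycleSum_mem_degreePart hc m

theorem support_eq_of_mem {c c' : List G.E} (hc : c ∈ G.cyclesS) (hc' : c' ∈ G.cyclesS) {x : G.V}
    (hx : x ∈ G.support c) (hx' : x ∈ G.support c') : G.support c = G.support c' :=
  (support_subset_of_mem hc.1 (isDet_of_mem_cyclesS hc') hx hx').antisymm
    (support_subset_of_mem hc'.1 (isDet_of_mem_cyclesS hc) hx' hx)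

/-- The index set depends only on the set of vertices of the cycle, and the powers only on their
base points and lengths. In particular, the rotations of a cycle all give one element of `basisSet`.
-/
theorem cycleSum_eq_of_support_eq {c c' : List G.E} (hc : c ∈ G.cyclesS) (hc' : c' ∈ G.cyclesS)
    (h : G.support c = G.support c') {m m' : ℕ} (hm : m * c.length = m' * c'.length) :
    G.cycleSum K c m = G.cycleSum K c' m' := by
  rw [cycleSum_eq_sum K hc, cycleSum_eq_sum K hc']
  have hS : G.sumIndex c = G.sumIndex c' := by rw [sumIndex, sumIndex, h]
  refine Finset.sum_congr (by ext; simp [hS]) fun α hα => ?_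
  have hα : α ∈ G.sumIndex c' := by simpa using hα
  have hr' := range_mem_of_mem_sumIndex hα
  have hr := hr'
  rw [← h] at hr
  rw [cycleTerm, cycleTerm, (isDet_of_mem_cyclesS hc).eq_of_length hr
    (hc.1.powList_isPathFrom m hr).1 (hc'.1.powList_isPathFrom m' hr').1 (by simpa using hm)]

/-- Multiplication by a vertex of `c` isolates the coefficient of the sum attached to `c`. -/
theorem linearIndepOn_basisSet_natCast (hG : G.RowFinite) (n : ℕ) :
    LinearIndepOn K id (G.basisSet K n) := by
  refine linearIndependent_iff'.2 fun s g hg i hi => ?_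
  obtain ⟨c, hc, m, hm, hic⟩ := mem_basisSet_natCast.1 i.2
  obtain ⟨e, he⟩ := List.exists_mem_of_ne_nil c hc.1.1
  have hu : G.src e ∈ G.support c := ⟨e, he, Or.inl rfl⟩
  have key : g i • G.real K (G.src e) (powList c m (G.src e)) = 0 := by
    have h := congrArg (vx K (G.src e) * ·) hg
    simp only [Finset.mul_sum, mul_smul_comm, id, mul_zero] at h
    rw [Finset.sum_eq_single i] at h
    · rwa [hic, vx_mul_cycleSum hc m hu] at h
    · intro j hj hji
      obtain ⟨c', hc', m', hm', hjc⟩ := mem_basisSet_natCast.1 j.2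
      rw [hjc, vx_mul_cycleSum_eq_zero hc', smul_zero]
      -- A path from a vertex of `c` cannot leave `c`. If it ends on `c'`, the two cycles share a
      -- vertex, hence all vertices, and the two sums are equal.
      rintro α hα hαe
      have hr := range_mem_of_mem_sumIndex hα
      have hr' : α.range ∈ G.support c :=
        (isDet_of_mem_cyclesS hc).endpoint_mem (hαe ▸ hu) α.isPath
      refine hji (Subtype.ext ?_)
      rw [hic, hjc]
      exact cycleSum_eq_of_support_eq hc' hc (support_eq_of_mem hc' hc hr hr') (hm'.trans hm.symm)
    · exact fun h => (h hi).elim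
  exact (smul_eq_zero.1 key).resolve_right (real_ne_zero hG (hc.1.powList_isPathFrom m hu).1)

/-! ### Homogeneous elements -/

/-- Finite sums of vertices are local left units. Allowing every larger `F'` lets two elements share
a unit. -/
theorem exists_sum_vx_mul_eq {n : ℤ} {z : G.LPA K} (hz : z ∈ G.degreePart K n) :
    ∃ F : Finset G.V, ∀ F', F ⊆ F' → (∑ x ∈ F', vx K x) * z = z := by
  classical
  induction hz using Submodule.span_induction with
  | mem z hz =>
    obtain ⟨α, β, -, rfl⟩ := hz
    refine ⟨{α.source}, fun F' hF' => ?_⟩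
    rw [Finset.sum_mul, Finset.sum_eq_single α.source]
    · rw [← mul_assoc, Path.toLPA, vx_mul_real α.isPath]
    · intro x _ hx
      rw [← mul_assoc, Path.toLPA, vx_mul_real_of_ne α.isPath hx, zero_mul]
    · exact fun h => (h (hF' (by simp))).elim
  | zero => exact ⟨∅, by simp⟩
  | add a b _ _ ha hb =>
    obtain ⟨F₁, h₁⟩ := ha
    obtain ⟨F₂, h₂⟩ := hb
    refine ⟨F₁ ∪ F₂, fun F' hF' => ?_⟩
    rw [mul_add, h₁ F' (Finset.union_subset_left hF'), h₂ F' (Finset.union_subset_right hF')]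
  | smul k a _ ha =>
    obtain ⟨F, h⟩ := ha
    exact ⟨F, fun F' hF' => by rw [mul_smul_comm, h F' hF']⟩

variable (G) in
/-- The vertices `x` with `x z ≠ 0`. -/
def vxSupport (z : G.LPA K) : Set G.V := {x | vx K x * z ≠ 0}

theorem vxSupport_finite {n : ℤ} {z : G.LPA K} (hz : z ∈ G.degreePart K n) :
    (G.vxSupport z).Finite := by
  obtain ⟨F, hF⟩ := exists_sum_vx_mul_eq hz
  refine F.finite_toSet.subset fun x hx => ?_
  by_contra hxF
  apply hx
  rw [← hF F subset_rfl, ← mul_assoc, Finset.mul_sum, Finset.sum_eq_zero, zero_mul]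
  intro y hy
  exact vx_mul_vx_of_ne fun h => hxF (h ▸ hy)

theorem eq_zero_of_forall_vx_mul {n : ℤ} {z : G.LPA K} (hz : z ∈ G.degreePart K n)
    (h : ∀ x, vx K x * z = 0) : z = 0 := by
  obtain ⟨F, hF⟩ := exists_sum_vx_mul_eq hz
  rw [← hF F subset_rfl, Finset.sum_mul]
  exact Finset.sum_eq_zero fun x _ => h x

/-- The only path starting at a sink `x` is `x` itself, so a term α β* that survives has degree 0.
-/
theorem vx_mul_mul_vx_eq_zero {n : ℤ} (hn : n ≠ 0) {z : G.LPA K} (hz : z ∈ G.degreePart K n)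
    {x : G.V} (hx : ∀ e, G.src e ≠ x) : vx K x * z * vx K x = 0 := by
  have key : ∀ α : G.Path, α.source = x → α.length = 0 := by
    rintro ⟨y, _ | ⟨e, l⟩, h⟩ rfl
    · rfl
    · exact (hx e h.1).elim
  induction hz using Submodule.span_induction with
  | mem z hz =>
    obtain ⟨α, β, hαβ, rfl⟩ := hz
    by_cases hα : α.source = x
    · by_cases hβ : β.source = x
      · rw [key α hα, key β hβ] at hαβ
        exact (hn (by simpa using hαβ.symm)).elim
      · rw [Path.star, mul_assoc, mul_assoc, ghost_mul_vx_of_ne β.isPath (Ne.symm hβ),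
          mul_zero, mul_zero]
    · rw [Path.toLPA, ← mul_assoc, vx_mul_real_of_ne α.isPath (Ne.symm hα), zero_mul, zero_mul]
  | zero => simp
  | add a b _ _ ha hb => rw [mul_add, add_mul, ha, hb, add_zero]
  | smul k a _ ha => rw [mul_smul_comm, smul_mul_assoc, ha, smul_zero]

variable (G) in
/-- The closed paths of length `n` based at `x`. -/
def closedPaths (x : G.V) (n : ℕ) : Set (List G.E) :=
  {p | G.IsPathFrom x p ∧ G.endpoint x p = x ∧ p.length = n}

/-- Compression by a long path turns homogeneous elements of degree `n ≥ 0` into combinations of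
closed paths. -/
theorem exists_ghost_mul_mul_real_mem {n : ℕ} {z : G.LPA K} (hz : z ∈ G.degreePart K n) :
    ∃ N : ℕ, ∀ x l, G.IsPathFrom x l → N ≤ l.length → G.ghost K x l * z * G.real K x l ∈
      Submodule.span K (G.real K (G.endpoint x l) '' G.closedPaths (G.endpoint x l) n) := by
  induction hz using Submodule.span_induction with
  | mem z hz =>
    obtain ⟨α, β, hαβ, rfl⟩ := hz
    -- For `l` at least as long as `β`, the product β* l is 0 or a real path `p` with l = β p.
    refine ⟨β.length, fun x l hl hβl => ?_⟩
    rw [mul_assoc, mul_assoc, Path.star]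
    rcases ghost_mul_real_eq_zero_or (K := K) β.isPath hl hβl with h | ⟨rfl, p, rfl, h⟩
    · rw [h, mul_zero, mul_zero]
      exact zero_mem _
    rw [h, Path.toLPA]
    have hp := (isPathFrom_append.1 hl).2
    rcases ne_or_eq α.range β.range with hne | hr
    · rw [real_mul_real_of_ne hp hne, mul_zero]
      exact zero_mem _
    have hr' : G.endpoint α.source α.edges = G.endpoint β.source β.edges := hr
    have hαp : G.IsPathFrom α.source (α.edges ++ p) :=
      isPathFrom_append.2 ⟨α.isPath, by rw [hr']; exact hp⟩
    rw [← hr', real_mul_real hαp]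
    -- As `n ≥ 0`, the path `α p` is at least as long as `l = β p`, so the second cancellation also
    -- leaves a real path.
    have hlen : (β.edges ++ p).length + n = (α.edges ++ p).length := by
      simp only [Path.length] at hαβ
      simp only [List.length_append]
      omega
    rcases ghost_mul_real_eq_zero_or (K := K) hl hαp (by omega) with h | ⟨hs, q, hq, h⟩
    · rw [h]
      exact zero_mem _
    · rw [h]
      rw [hq, ← hs, isPathFrom_append] at hαp
      refine Submodule.subset_span ⟨q, ⟨hαp.2, ?_, ?_⟩, rfl⟩
      · rw [← endpoint_append, ← hq, hs, endpoint_append, endpoint_append, hr', hs]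
      · rw [hq, List.length_append (bs := q)] at hlen
        omega
  | zero => exact ⟨0, by simp⟩
  | add a b _ _ ha hb =>
    obtain ⟨N₁, h₁⟩ := ha
    obtain ⟨N₂, h₂⟩ := hb
    refine ⟨max N₁ N₂, fun x l hl hN => ?_⟩
    rw [mul_add, add_mul]
    exact add_mem (h₁ x l hl (le_of_max_le_left hN)) (h₂ x l hl (le_of_max_le_right hN))
  | smul k a _ ha =>
    obtain ⟨N, h⟩ := ha
    refine ⟨N, fun x l hl hN => ?_⟩
    rw [mul_smul_comm, smul_mul_assoc]
    exact Submodule.smul_mem _ _ (h x l hl hN)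

/-! ### Central homogeneous elements -/

section Central

variable {z : G.LPA K} (hz : ∀ a, a * z = z * a)
include hz

theorem vx_endpoint_mul {x : G.V} {l : List G.E} (h : G.IsPathFrom x l) :
    vx K (G.endpoint x l) * z = G.ghost K x l * z * G.real K x l := by
  rw [← ghost_mul_real_self h, mul_assoc, mul_assoc, hz]

/-- For a path `l` from `x`, centrality gives r(l) z = l* z l = l* (x z) l. -/
theorem vx_mul_ne_zero_of_endpoint {x : G.V} {l : List G.E} (h : G.IsPathFrom x l)
    (h0 : vx K (G.endpoint x l) * z ≠ 0) : vx K x * z ≠ 0 := by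
  intro hx
  apply h0
  rw [vx_endpoint_mul hz h, ← ghost_mul_vx h, mul_assoc _ (vx K x), hx, mul_zero, zero_mul]

theorem gh_mul_mul_ed_of_ne {e f : G.E} (h : e ≠ f) : gh K e * z * ed K f = 0 := by
  rw [hz, mul_assoc, gh_mul_ed_of_ne h, mul_zero]

theorem gh_mul_eq_zero {e : G.E} (h : vx K (G.rng e) * z = 0) : gh K e * z = 0 := by
  rw [← vx_rng_mul_gh, mul_assoc, hz (gh K e), ← mul_assoc, h, zero_mul]

/-- CK2 expands `x` along its edges, and e* z = 0 once r(e) z = 0. A sink reached before length `k`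
is harmless, since there x z = x z x = 0. -/
theorem vx_mul_eq_zero_of_forall_path (hG : G.RowFinite) {n : ℤ} (hn : n ≠ 0)
    (hzn : z ∈ G.degreePart K n) (k : ℕ) (x : G.V)
    (h : ∀ l, G.IsPathFrom x l → l.length = k → vx K (G.endpoint x l) * z = 0) :
    vx K x * z = 0 := by
  induction k generalizing x with
  | zero => exact h [] trivial rfl
  | succ k ih =>
    by_cases hx : ∃ e, G.src e = x
    · rw [vx_eq_sum ⟨hx, hG x⟩, Finset.sum_mul]
      refine Finset.sum_eq_zero fun e he => ?_
      have he : G.src e = x := by simpa using he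
      rw [mul_assoc, gh_mul_eq_zero hz (ih (G.rng e) fun l hl hk => ?_), mul_zero]
      exact h (e :: l) ⟨he, hl⟩ (by simp [hk])
    · push Not at hx
      rw [← vx_mul_self, mul_assoc, hz (vx K x), ← mul_assoc]
      exact vx_mul_mul_vx_eq_zero hn hzn hx

variable (G) in
omit hz in
/-- The ends `x` of paths of length at least `N` such that `x z ≠ 0`. -/
def longEnds (z : G.LPA K) (N : ℕ) : Set G.V :=
  {x | vx K x * z ≠ 0 ∧ ∃ y l, G.IsPathFrom y l ∧ N ≤ l.length ∧ G.endpoint y l = x}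

variable {n N : ℕ} (hn : n ≠ 0) (hN : ∀ x l, G.IsPathFrom x l → N ≤ l.length →
  vx K (G.endpoint x l) * z ∈
    Submodule.span K (G.real K (G.endpoint x l) '' G.closedPaths (G.endpoint x l) n))
include hn hN

/-- If a closed path `e q` occurs in `x z` with coefficient k ≠ 0, then (e q)* z = k x. For an edge
`f ≠ e` from `x`, the relation e* z f = z e* f = 0 then gives k f = 0, hence k r(f) = 0, a
contradiction. -/
theorem exists_closedPath_of_mem_longEnds (hG : G.RowFinite) {x : G.V}
    (hx : x ∈ G.longEnds z N) :
    ∃ e q, G.IsPathFrom x (e :: q) ∧ G.endpoint x (e :: q) = x ∧ (e :: q).length = n ∧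
      ∀ f, G.src f = x → e = f := by
  obtain ⟨hx0, y, l, hl, hNl, rfl⟩ := hx
  generalize hw : G.endpoint y l = w at hx0
  have hmem := hN y l hl hNl
  rw [hw] at hmem
  obtain ⟨k, hk, hkz⟩ := (Finsupp.mem_span_image_iff_linearCombination K).1 hmem
  have hk' : ∀ p ∈ k.support, p ∈ G.closedPaths w n := fun p hp => hk hp
  obtain ⟨p, hp⟩ : ∃ p, p ∈ k.support := by
    by_contra! h
    have : k = 0 := Finsupp.support_eq_empty.1 (Finset.eq_empty_of_forall_notMem h)
    rw [this, map_zero] at hkz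
    exact hx0 hkz.symm
  have hpw := hk' p hp
  -- Distinct paths of equal length are orthogonal, so p* reads off the coefficient of `p`.
  have hcoeff : G.ghost K w p * (vx K w * z) = k p • vx K w := by
    rw [← hkz, Finsupp.linearCombination_apply, Finsupp.sum, Finset.mul_sum,
      Finset.sum_eq_single p]
    · rw [mul_smul_comm, ghost_mul_real_self hpw.1, hpw.2.1]
    · intro q hq hqp
      have hqw := hk' q hq
      rw [mul_smul_comm, ghost_mul_real_of_ne hpw.1 hqw.1 (hpw.2.2.trans hqw.2.2.symm) hqp.symm,
        smul_zero]
    · exact fun h => (h hp).elim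
  cases p with
  | nil => exact (hn hpw.2.2.symm).elim
  | cons e q =>
    refine ⟨e, q, hpw.1, hpw.2.1, hpw.2.2, fun f hf => ?_⟩
    by_contra hne
    have h : k (e :: q) • ed K f = 0 := by
      calc k (e :: q) • ed K f = (k (e :: q) • vx K w) * ed K f := by
            rw [smul_mul_assoc, ← hf, vx_src_mul_ed]
        _ = G.ghost K (G.rng e) q * (gh K e * z * ed K f) := by
            rw [← hcoeff, ← mul_assoc, ghost_mul_vx hpw.1, ghost]
            simp only [mul_assoc]
        _ = 0 := by rw [gh_mul_mul_ed_of_ne hz hne, mul_zero]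
    have h' : k (e :: q) • vx K (G.rng f) = 0 := by
      rw [← gh_mul_ed_self, ← mul_smul_comm, h, mul_zero]
    exact (Finsupp.mem_support_iff.1 hp) ((smul_eq_zero.1 h').resolve_right (vx_ne_zero hG _))

/-- If `e` is the only edge from `s(e)`, CK2 reads s(e) = e e*, so r(e) z = 0 would force s(e) z =
0. -/
theorem isDet_longEnds (hG : G.RowFinite) : IsDet (G.longEnds z N) := by
  have heq : ∀ e f, G.src e ∈ G.longEnds z N → G.src e = G.src f → e = f := by
    intro e f he hef
    obtain ⟨g, -, -, -, -, hg⟩ := exists_closedPath_of_mem_longEnds hz hn hN hG he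
    rw [← hg e rfl, hg f hef.symm]
  refine ⟨fun e he => ⟨fun h0 => he.1 ?_, ?_⟩, heq⟩
  · rw [vx_eq_sum ⟨⟨e, rfl⟩, hG _⟩, Finset.sum_mul]
    refine Finset.sum_eq_zero fun f hf => ?_
    have hf : G.src f = G.src e := by simpa using hf
    rw [← heq e f he hf.symm, mul_assoc, gh_mul_eq_zero hz h0, mul_zero]
  · obtain ⟨-, y, l, hl, hNl, hy⟩ := he
    exact ⟨y, l ++ [e], isPathFrom_append.2 ⟨hl, hy.symm, trivial⟩,
      by rw [List.length_append]; omega, by simp [endpoint]⟩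

theorem exists_smul_real_of_mem_longEnds (hG : G.RowFinite) {x : G.V}
    (hx : x ∈ G.longEnds z N) :
    ∃ p ∈ G.closedPaths x n, ∃ k : K, vx K x * z = k • G.real K x p := by
  obtain ⟨e, q, h₁, h₂, h₃, -⟩ := exists_closedPath_of_mem_longEnds hz hn hN hG hx
  refine ⟨e :: q, ⟨h₁, h₂, h₃⟩, ?_⟩
  have hsub : G.closedPaths x n ⊆ {e :: q} := fun p hp =>
    (isDet_longEnds hz hn hN hG).eq_of_length hx hp.1 h₁ (hp.2.2.trans h₃.symm)
  obtain ⟨-, y, l, hl, hNl, rfl⟩ := hx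
  have hmem := Submodule.span_mono (Set.image_mono hsub) (hN y l hl hNl)
  rw [Set.image_singleton] at hmem
  obtain ⟨k, hk⟩ := Submodule.mem_span_singleton.1 hmem
  exact ⟨k, hk.symm⟩

omit hN in
theorem longEnds_nonempty (hG : G.RowFinite) (hzn : z ∈ G.degreePart K n) (hz0 : z ≠ 0) :
    (G.longEnds z N).Nonempty := by
  by_contra hne
  refine hz0 (eq_zero_of_forall_vx_mul hzn fun x => ?_)
  refine vx_mul_eq_zero_of_forall_path hz hG (by exact_mod_cast hn) hzn N x fun l hl hlN => ?_
  by_contra h0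
  exact hne ⟨_, h0, x, l, hl, hlN.ge, rfl⟩

end Central

/-! ### Shortest closed paths -/

theorem endpoint_take {x : G.V} {l : List G.E} (h : G.IsPathFrom x l) {i : ℕ}
    (hi : i < l.length) : G.endpoint x (l.take i) = G.src l[i] := by
  rw [← List.take_append_drop i l, isPathFrom_append, List.drop_eq_getElem_cons hi] at h
  exact h.2.1.symm

/-- If two edges had the same source, cutting out the segment between them would leave a shorter
nonempty closed path at `x`. -/
theorem isCycle_of_shortest {x : G.V} {c : List G.E} (hc0 : c ≠ []) (hc : G.IsPathFrom x c)
    (hcx : G.endpoint x c = x)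
    (hmin : ∀ p, p ≠ [] → G.IsPathFrom x p → G.endpoint x p = x → c.length ≤ p.length) :
    G.IsCycle c := by
  refine ⟨hc0, ⟨x, hc, hcx⟩, ?_⟩
  rw [List.nodup_iff_pairwise_ne, List.pairwise_iff_getElem]
  intro i j hi hj hij heq
  simp only [List.length_map] at hi hj
  simp only [List.getElem_map] at heq
  rw [← endpoint_take hc hi, ← endpoint_take hc hj] at heq
  have hc' := hc
  rw [← List.take_append_drop i c, isPathFrom_append] at hc'
  rw [← List.take_append_drop j c, isPathFrom_append] at hc
  rw [← List.take_append_drop j c, endpoint_append] at hcx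
  have := hmin (c.take i ++ c.drop j) (by simp; omega)
    (isPathFrom_append.2 ⟨hc'.1, by rw [heq]; exact hc.2⟩) (by rw [endpoint_append, heq, hcx])
  simp only [List.length_append, List.length_take, List.length_drop] at this
  omega

/-- The shortest closed path is a prefix of every nonempty closed path at `x`. Removing it leaves a
shorter closed path. -/
theorem IsDet.length_dvd {A : Set G.V} (hA : IsDet A) {x : G.V} (hx : x ∈ A) {c : List G.E}
    (hc0 : c ≠ []) (hc : G.IsPathFrom x c) (hcx : G.endpoint x c = x)
    (hmin : ∀ p, p ≠ [] → G.IsPathFrom x p → G.endpoint x p = x → c.length ≤ p.length)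
    {p : List G.E} (hp : G.IsPathFrom x p) (hpx : G.endpoint x p = x) :
    c.length ∣ p.length := by
  induction hk : p.length using Nat.strong_induction_on generalizing p with
  | _ k ih =>
    subst hk
    rcases eq_or_ne p [] with rfl | hp0
    · simp
    obtain ⟨q, rfl⟩ := hA.isPrefix hx hc hp (hmin p hp0 hp hpx)
    rw [isPathFrom_append, hcx] at hp
    rw [endpoint_append, hcx] at hpx
    have := List.length_pos_iff.2 hc0
    rw [List.length_append]
    exact (Nat.dvd_add_right (dvd_refl _)).2 (ih _ (by rw [List.length_append]; omega) hp.2 hpx rfl)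

/-! ### The center in positive degree -/

section Central

variable {z : G.LPA K} (hz : ∀ a, a * z = z * a) {n N : ℕ} (hn : n ≠ 0)
  (hN : ∀ x l, G.IsPathFrom x l → N ≤ l.length → vx K (G.endpoint x l) * z ∈
    Submodule.span K (G.real K (G.endpoint x l) '' G.closedPaths (G.endpoint x l) n))
include hz hn hN

/-- A path ending on `c` starts in the finite set `vxSupport z`. If it is longer than `N + l(c)`, it
is already on `c` after `N` edges, and the rest goes around the whole cycle. Row-finiteness leaves
finitely many shorter paths. -/
theorem mem_cyclesS_of_subset_longEnds (hG : G.RowFinite) (hzn : z ∈ G.degreePart K n)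
    {c : List G.E} (hc : G.IsCycle c) (hcA : G.support c ⊆ G.longEnds z N) :
    c ∈ G.cyclesS := by
  have hA := isDet_longEnds hz hn hN hG
  have hex : ∀ f, ¬ G.IsExit f c := by
    rintro f ⟨e, he, hfe, hne⟩
    exact hne (hA.eq_of_src e f (hcA ⟨e, he, Or.inl rfl⟩) hfe.symm).symm
  have hB := isDet_support hc hex
  refine ⟨hc, hex, (finite_paths_of_length_le hG (vxSupport_finite hzn)
    (N + c.length)).subset ?_⟩
  rintro α ⟨hr, hnot⟩
  have hr0 : vx K α.range * z ≠ 0 := (hcA hr).1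
  refine ⟨vx_mul_ne_zero_of_endpoint hz α.isPath hr0, ?_⟩
  by_contra! hlen
  rw [Path.length] at hlen
  apply hnot
  have hα := α.isPath
  have hαr : G.endpoint α.source α.edges = α.range := rfl
  rw [← List.take_append_drop N α.edges, isPathFrom_append] at hα
  rw [← List.take_append_drop N α.edges, endpoint_append] at hαr
  set x := G.endpoint α.source (α.edges.take N) with hx
  have hxA : x ∈ G.longEnds z N := by
    refine ⟨vx_mul_ne_zero_of_endpoint hz hα.2 (by rwa [hαr]), _, _, hα.1, ?_, rfl⟩
    rw [List.length_take]
    omega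
  obtain ⟨e, q, hq, hqx, -, -⟩ := exists_closedPath_of_mem_longEnds hz hn hN hG hxA
  -- `x` lies on a closed path in a set where paths cannot branch, so a path from `x` into `c` can
  -- be continued back to `x` without leaving `c`.
  have hxc : x ∈ G.support c :=
    hA.mem_of_endpoint_mem hB hxA hq hqx (by simp) hα.2 (by rwa [hαr])
  have hpre := hB.isPrefix hxc (hc.basedAt_isPathFrom hxc).1 hα.2 (by
    rw [length_basedAt, List.length_drop]
    omega)
  exact fun e he => List.drop_subset _ _ (hpre.subset (mem_basedAt.2 he))

/-- Some multiple of a sum attached to a cycle has the same component as `z` at a vertex. -/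
theorem exists_cycleSum_of_mem_longEnds (hG : G.RowFinite) (hzn : z ∈ G.degreePart K n)
    {x : G.V} (hx : x ∈ G.longEnds z N) :
    ∃ c ∈ G.cyclesS, ∃ m : ℕ, m * c.length = n ∧ G.support c ⊆ G.longEnds z N ∧
      ∃ k : K, vx K x * z = k • (vx K x * G.cycleSum K c m) := by
  classical
  have hA := isDet_longEnds hz hn hN hG
  obtain ⟨p, ⟨hp, hpx, hpn⟩, k, hk⟩ := exists_smul_real_of_mem_longEnds hz hn hN hG hx
  -- The cycle is a shortest nonempty closed path at `x`; `p` shows that one exists.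
  have hex : ∃ j, ∃ c : List G.E, c ≠ [] ∧ G.IsPathFrom x c ∧ G.endpoint x c = x ∧
      c.length = j :=
    ⟨n, p, by rintro rfl; exact hn hpn.symm, hp, hpx, hpn⟩
  obtain ⟨c, hc0, hcp, hcx, hcl⟩ := Nat.find_spec hex
  have hmin : ∀ q, q ≠ [] → G.IsPathFrom x q → G.endpoint x q = x → c.length ≤ q.length :=
    fun q hq0 hq hqx => hcl ▸ Nat.find_min' hex ⟨q, hq0, hq, hqx, rfl⟩
  have hc := isCycle_of_shortest hc0 hcp hcx hmin
  have hxc : x ∈ G.support c := by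
    cases c with
    | nil => exact (hc0 rfl).elim
    | cons e c => exact ⟨e, by simp, Or.inl hcp.1⟩
  have hcA := support_subset_of_mem hc hA hxc hx
  have hcS := mem_cyclesS_of_subset_longEnds hz hn hN hG hzn hc hcA
  obtain ⟨m, hm⟩ := hA.length_dvd hx hc0 hcp hcx hmin hp hpx
  refine ⟨c, hcS, m, by rw [mul_comm, ← hm, hpn], hcA, k, ?_⟩
  rw [vx_mul_cycleSum hcS m hxc, hk,
    hA.eq_of_length hx hp (hc.powList_isPathFrom m hxc).1 (by rw [hm, length_powList, mul_comm])]

end Central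

theorem mem_centerPart_iff {n : ℤ} {z : G.LPA K} :
    z ∈ G.centerPart K n ↔ (∀ a, a * z = z * a) ∧ z ∈ G.degreePart K n :=
  and_congr_left' (NonUnitalSubalgebra.mem_center_iff (R := K))

/-- Induction on the number of vertices `x` with x z ≠ 0. -/
theorem centerPart_natCast_le (hG : G.RowFinite) {n : ℕ} (hn : n ≠ 0) {z : G.LPA K}
    (hz : z ∈ G.centerPart K n) : z ∈ Submodule.span K (G.basisSet K n) := by
  induction hk : (G.vxSupport z).ncard using Nat.strong_induction_on generalizing z with
  | _ j ih =>
    subst hk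
    by_cases hz0 : z = 0
    · rw [hz0]
      exact zero_mem _
    obtain ⟨hzc, hzn⟩ := mem_centerPart_iff.1 hz
    obtain ⟨N, hN⟩ := exists_ghost_mul_mul_real_mem hzn
    replace hN : ∀ x l, G.IsPathFrom x l → N ≤ l.length → vx K (G.endpoint x l) * z ∈
        Submodule.span K (G.real K (G.endpoint x l) '' G.closedPaths (G.endpoint x l) n) :=
      fun x l hl hNl => by
        rw [vx_endpoint_mul hzc hl]
        exact hN x l hl hNl
    obtain ⟨x, hx⟩ := longEnds_nonempty hzc hn hG hzn hz0
    obtain ⟨c, hc, m, hm, hcA, k, hk⟩ := exists_cycleSum_of_mem_longEnds hzc hn hN hG hzn hx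
    have hmem : G.cycleSum K c m ∈ G.basisSet K n := mem_basisSet_natCast.2 ⟨c, hc, m, hm, rfl⟩
    have hlt : (G.vxSupport (z - k • G.cycleSum K c m)).ncard < (G.vxSupport z).ncard := by
      -- Every vertex that does not annihilate the sum is the source of a path ending on `c`, hence
      -- is already in `vxSupport z`.
      have hsub : G.vxSupport (z - k • G.cycleSum K c m) ⊆ G.vxSupport z := by
        intro y hy hy0
        apply hy
        rw [mul_sub, mul_smul_comm, hy0, vx_mul_cycleSum_eq_zero hc, smul_zero, sub_zero]
        rintro α hα rfl
        exact vx_mul_ne_zero_of_endpoint hzc α.isPath (hcA (range_mem_of_mem_sumIndex hα)).1 hy0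
      refine Set.ncard_lt_ncard ((Set.ssubset_iff_of_subset hsub).2 ⟨x, hx.1, fun h => h ?_⟩)
        (vxSupport_finite hzn)
      rw [mul_sub, mul_smul_comm, hk, sub_self]
    have hsub := ih _ hlt (Submodule.sub_mem _ hz
      (Submodule.smul_mem _ k (basisSet_natCast_subset hG n hmem))) rfl
    have := Submodule.add_mem _ hsub (Submodule.smul_mem _ k (Submodule.subset_span hmem))
    rwa [sub_add_cancel] at this

/-! ### The involution exchanges opposite degrees -/

theorem star_mem_degreePart {n : ℤ} {a : G.LPA K} (ha : a ∈ G.degreePart K n) :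
    Star.star a ∈ G.degreePart K (-n) := by
  induction ha using Submodule.span_induction with
  | mem a ha =>
    obtain ⟨α, β, h, rfl⟩ := ha
    refine Submodule.subset_span ⟨β, α, by omega, ?_⟩
    rw [star_mul, Path.toLPA, Path.star, star_ghost, star_real]
    rfl
  | zero => simp
  | add a b _ _ ha hb => rw [star_add]; exact add_mem ha hb
  | smul k a _ ha => rw [star_smul']; exact Submodule.smul_mem _ _ ha

theorem star_mem_centerPart {n : ℤ} {a : G.LPA K} (ha : a ∈ G.centerPart K n) :
    Star.star a ∈ G.centerPart K (-n) := by
  obtain ⟨hc, hn⟩ := mem_centerPart_iff.1 ha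
  refine mem_centerPart_iff.2 ⟨fun b => ?_, star_mem_degreePart hn⟩
  simpa using (congrArg Star.star (hc (Star.star b))).symm

@[simp]
theorem star_closedPow (x : G.V) (c : List G.E) (m : ℤ) :
    Star.star (G.closedPow K x c m) = G.closedPow K x c (-m) := by
  rcases lt_trichotomy m 0 with h | rfl | h
  · rw [closedPow, closedPow, if_neg (by omega), if_pos (by omega), star_ghost, Int.natAbs_neg]
  · simp [closedPow, real]
  · rw [closedPow, closedPow, if_pos (by omega), if_neg (by omega), star_real, Int.natAbs_neg]

theorem star_cycleSum (c : List G.E) (m : ℤ) :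
    Star.star (G.cycleSum K c m) = G.cycleSum K c (-m) := by
  change starAddEquiv (G.cycleSum K c m) = _
  simp only [cycleSum, AddEquiv.map_finsum]
  refine finsum_congr fun α => finsum_congr fun _ => finsum_congr fun x => finsum_congr fun _ => ?_
  simp [Path.toLPA, Path.star, mul_assoc]

theorem star_image_basisSet (n : ℤ) :
    starLinear G K '' G.basisSet K n = G.basisSet K (-n) := by
  have key : ∀ n : ℤ, ∀ a ∈ G.basisSet K n, Star.star a ∈ G.basisSet K (-n) := by
    rintro n _ ⟨c, hc, m, rfl, rfl⟩
    exact ⟨c, hc, -m, by ring, star_cycleSum c m⟩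
  refine Set.Subset.antisymm (Set.image_subset_iff.2 fun a ha => key n a ha) fun a ha => ?_
  exact ⟨Star.star a, by simpa using key _ a ha, star_star a⟩

end DirectedGraph

end

/-- For a row-finite graph `G` and `n ≠ 0`, the set `basisSet K n` is a basis of the component of
degree `n` of the center of the Leavitt path algebra. -/
theorem theorem3p24 (K : Type w) [Field K] (G : DirectedGraph.{u, v}) (hG : G.RowFinite)
    (n : ℤ) (hn : n ≠ 0) :
    G.basisSet K n ⊆ G.centerPart K n ∧
      LinearIndepOn K id (G.basisSet K n) ∧
      Submodule.span K (G.basisSet K n) = G.centerPart K n := by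
  suffices h : G.basisSet K n ⊆ G.centerPart K n ∧ LinearIndepOn K id (G.basisSet K n) ∧
      G.centerPart K n ≤ Submodule.span K (G.basisSet K n) from
    ⟨h.1, h.2.1, (Submodule.span_le.2 h.1).antisymm h.2.2⟩
  obtain ⟨k, rfl | rfl⟩ := n.eq_nat_or_neg
  · exact ⟨DirectedGraph.basisSet_natCast_subset hG k,
      DirectedGraph.linearIndepOn_basisSet_natCast hG k,
      fun z hz => DirectedGraph.centerPart_natCast_le hG (by exact_mod_cast hn) hz⟩
  -- In degree `-k`, all three claims are carried over from degree `k` by the involution.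
  · rw [← DirectedGraph.star_image_basisSet]
    refine ⟨?_, ?_, fun z hz => ?_⟩
    · rintro _ ⟨a, ha, rfl⟩
      exact DirectedGraph.star_mem_centerPart (DirectedGraph.basisSet_natCast_subset hG k ha)
    · exact (DirectedGraph.linearIndepOn_basisSet_natCast hG k).id_imageₛ
        (f := (DirectedGraph.starLinear G K).toLinearMap)
        (DirectedGraph.starLinear G K).injective.injOn
    · have h := DirectedGraph.centerPart_natCast_le hG (n := k) (by simpa using hn)
        (by simpa using DirectedGraph.star_mem_centerPart hz)
      have h' := Submodule.mem_map_of_mem (f := (DirectedGraph.starLinear G K).toLinearMap) h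
      rw [Submodule.map_span] at h'
      simpa using h'
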